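/- **Data and energies.** Let $N\ge 1$, $x_1<\dots<x_N$ real, $y_1,\dots,y_N\in\mathbb R$, $\delta_1,\dots,\delta_N>0$, $p\in(0,1)$. For an interval $I\subseteq\mathbb R$ containing exactly the sites $x_1,\dots,x_r$ put $$\mathcal E_{1:r}=\min_{f\in C^2(I)}\; p\sum_{i:\,x_i\in I}\Big(\frac{y_i-f(x_i)}{\delta_i}\Big)^2+(1-p)\int_I f''(t)^2\,dt .$$ **The banded system.** Let $\alpha_i=\sqrt p/\delta_i$, $\beta=\sqrt{1-p}$, $d_i=x_{i+1}-x_i$ and $$[V_i\,|\,W_i]=\begin{bmatrix}2\sqrt3\,d_i^{-3/2}&\sqrt3\,d_i^{-1/2}&-2\sqrt3\,d_i^{-3/2}&\sqrt3\,d_i^{-1/2}\\0&d_i^{-1/2}&0&-d_i^{-1/2}\end{bmatrix},\qquad V_i,W_i\in\mathbb R^{2\times2}.$$ Let $A^{(r)}\in\mathbb R^{(3r-2)\times 2r}$ be the matrix with block rows $\alpha_1e_1^T,\ \beta[V_1\,W_1],\ \alpha_2e_1^T,\ \beta[V_2\,W_2],\dots,\beta[V_{r-1}\,W_{r-1}],\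 \alpha_re_1^T$, where $e_1^T=[1,0]$, the row $\alpha_ie_1^T$ stands in the columns $2i-1,2i$, and $\beta[V_i\,W_i]$ stands in the columns $2i-1,\dots,2i+2$. Let $\tilde y^{(r)}\in\mathbb R^{3r-2}$ be zero except for $\tilde y^{(r)}_{3i-2}=\alpha_iy_i$, $i=1,\dots,r$. **The update scheme.** Set $\mathcal E_{1:1}=0$. For $r=2$ triangularize the $4\times4$ system $[A^{(2)}|\tilde y^{(2)}]$ by Givens rotations to $[R|z]$, and set $\mathcal E_{1:2}=0$. To pass from $r$ to $r+1$ ($2\le r<N$), take the last two rows of the triangular part of $[R|z]$ together with the three new rows, $$\left[\begin{array}{cc|c}R_{2r-1:2r,\,2r-1:2r}&0&z_{2r-1:2r}\\ \beta V_r&\beta W_r&0\\0&\alpha_{r+1}e_1^T&\alpha_{r+1}y_{r+1}\end{array}\right],$$ bring this $5\times4$ system with right-hand side to upper triangular form $[R'|z']$ by at most $10$ Givens rotations, let its first four rows be rows $2r-1,\dots,2r+2$ of the new $[R|z]$, append $z'_5$ to the residual entries of $z$, and set $\mathcal E_{1:r+1}=\mathcal E_{1:r}+(z_5')^2$. The scheme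 is written as one fixed program (not depending on $N$ or the data) for a real random access machine with unit-cost operations $+,-,\cdot,/,\sqrt{\ }$, zero tests, index registers and counted loops; $R$ is kept in band storage. **Theorem.** There is an absolute constant $C$ such that for all data as above the following holds. 1. On input $N,x,y,\delta,p$ the program uses at most $CN$ steps and at most $CN$ real memory cells. 2. Its output array is $[\mathcal E_{1:1},\dots,\mathcal E_{1:N}]$: for every $1\le r\le N$ and every interval $I$ that contains exactly the sites $x_1,\dots,x_r$, the minimum above is attained and equals the $r$-th entry of the output. 3. For every $2\le r\le N$, after $r$ sites have been processed, the stored $[R|z]$ is a QR form of $[A^{(r)}|\tilde y^{(r)}]$: there is an orthogonal $Q$ with $A^{(r)}=QR$ and $z=Q^T\tilde y^{(r)}$, and $R$ is upper triangular with rows $2r+1,\dots,3r-2$ zero. The $r$-th output is $\sum_{i=2r+1}^{3r-2}z_i^2$. 4. For every $2\le r<N$, the update from $r$ to $r+1$ transforms the displayed $5\times 4$ system with right-hand side into the stored triangular one by a product of at most $10$ Givens rotations, leaves the rows $1,\dots,2r-2$ of $[R|z]$ and the earlier residual entries unchanged, and the $(r+1)$-st output is the $r$-th output plus $(z'_5)^2$.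 -/

import Mathlib

namespace CSSD

/-! ## A unit-cost real random access machine

The memory consists of arrays of real numbers (named by elements of `F`, entries indexed by `ℕ`) and
of index registers holding natural numbers.  A program is a finite structured text.  It can perform
one arithmetic operation `+, -, *, /, √` on real cells, move index registers by one, test for zero,
and repeat a block as often as an index register says.  Since a program text is finite and index
registers can only be set to constants, copied, incremented and decremented, they occupy a constant
number of words.  (`a / 0 = 0` and `√a = 0` for `a < 0`, as a convention.) -/

/-- Address of a real cell: a fixed entry of an array, or an entry relative to an index register. -/
inductive Addr (F : Type) where
  | fixed (f : F) (c : ℕ)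
  | rel (f : F) (j : ℕ) (c : ℕ)

/-- Arithmetic operations of the machine. -/
inductive Arith where
  | add
  | sub
  | mul
  | div

/-- Programs of the machine. -/
inductive Prog (F : Type) where
  | skip
  | const (dst : Addr F) (c : ℕ)
  | copy (dst src : Addr F)
  | arith (op : Arith) (dst a b : Addr F)
  | sqrt (dst a : Addr F)
  | setIdx (j c : ℕ)
  | copyIdx (j i : ℕ)
  | incIdx (j : ℕ)
  | decIdx (j : ℕ)
  | seq (P Q : Prog F)
  | ifZero (a : Addr F) (P Q : Prog F)
  | ifIdxZero (j : ℕ) (P Q : Prog F)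
  | loop (j : ℕ) (P : Prog F)

/-- Machine states: contents of the real cells and of the index registers, the number of steps
executed so far, and the set of real cells read or written so far. -/
structure State (F : Type) where
  mem : F × ℕ → ℝ
  idx : ℕ → ℕ
  steps : ℕ
  touched : Finset (F × ℕ)

variable {F : Type} [DecidableEq F]

/-- The cell an address refers to. -/
def Addr.cell (a : Addr F) (s : State F) : F × ℕ :=
  match a with
  | .fixed f c => (f, c)
  | .rel f j c => (f, s.idx j + c)

/-- The real number stored at an address. -/
def State.read (s : State F) (a : Addr F) : ℝ := s.mem (a.cell s)

/-- One step that writes `v` to `dst` after reading the addresses `srcs`. -/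
def State.assign (s : State F) (dst : Addr F) (srcs : List (Addr F)) (v : ℝ) : State F where
  mem := Function.update s.mem (dst.cell s) v
  idx := s.idx
  steps := s.steps + 1
  touched := s.touched ∪ ((dst :: srcs).map (fun a => a.cell s)).toFinset

/-- One step that writes `v` to the index register `j`. -/
def State.assignIdx (s : State F) (j v : ℕ) : State F :=
  { s with idx := Function.update s.idx j v, steps := s.steps + 1 }

/-- `n` steps of control flow. -/
def State.tick (s : State F) (n : ℕ) : State F := { s with steps := s.steps + n }

/-- Meaning of the arithmetic operations. -/
noncomputable def Arith.eval : Arith → ℝ → ℝ → ℝ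
  | .add, a, b => a + b
  | .sub, a, b => a - b
  | .mul, a, b => a * b
  | .div, a, b => a / b

/-- Execution of a program.  Every instruction and every test costs one step; a loop that performs
`n` iterations costs `n + 1` steps in addition to the cost of the iterations. -/
noncomputable def exec : Prog F → State F → State F
  | .skip, s => s
  | .const dst c, s => s.assign dst [] (c : ℝ)
  | .copy dst src, s => s.assign dst [src] (s.read src)
  | .arith op dst a b, s => s.assign dst [a, b] (op.eval (s.read a) (s.read b))
  | .sqrt dst a, s => s.assign dst [a] (Real.sqrt (s.read a))
  | .setIdx j c, s => s.assignIdx j c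
  | .copyIdx j i, s => s.assignIdx j (s.idx i)
  | .incIdx j, s => s.assignIdx j (s.idx j + 1)
  | .decIdx j, s => s.assignIdx j (s.idx j - 1)
  | .seq P Q, s => exec Q (exec P s)
  | .ifZero a P Q, s =>
      let t : State F := { s.tick 1 with touched := insert (a.cell s) s.touched }
      if s.read a = 0 then exec P t else exec Q t
  | .ifIdxZero j P Q, s => if s.idx j = 0 then exec P (s.tick 1) else exec Q (s.tick 1)
  | .loop j P, s => (exec P)^[s.idx j] (s.tick (s.idx j + 1))

/-- Sequential composition of a list of programs. -/
def block {F : Type} : List (Prog F) → Prog F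
  | [] => .skip
  | P :: Ps => .seq P (block Ps)

/-! ## The update scheme as a program -/

/-- The arrays used.  Data sites, values and deviations are `x`, `y`, `δ`, the parameter is `p`, and
the result is `out`; sites are numbered from `0`.  `R a b` (`a < 2`, `b < 5`) is the band storage of
the triangularized system `[R | z]`: at index `k` it holds, for row `2 k + a`, the entry in column
`2 k + b` if `b < 4`, and the right-hand side if `b = 4`.  `res` at index `i` holds the residual
entry produced when site `i` was added.  `ws i j` is a `5 × 5` workspace for a small system together
with its right-hand side (column `4`), and `tmp` holds temporaries. -/
inductive Field where
  | x
  | y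
  | δ
  | p
  | out
  | R (a b : ℕ)
  | res
  | ws (i j : ℕ)
  | tmp
  deriving DecidableEq

/-- Workspace entry. -/
def W (i j : ℕ) : Addr Field := .fixed (.ws i j) 0

/-- Temporary. -/
def T (i : ℕ) : Addr Field := .fixed .tmp i

/-- Register `0`: the number `N` of sites.  Register `1`: the last site processed so far.
Register `2`: the number of updates.  `cur f o` is the entry of `f` at `o` sites after the last one. -/
def cur (f : Field) (o : ℕ) : Addr Field := .rel f 1 o

/-- Givens rotation of the workspace rows `j` and `i` that annihilates the entry `(i, j)`. -/
def rotate (j i : ℕ) : Prog Field :=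
  .ifZero (W i j) .skip (block (
    [.arith .mul (T 0) (W j j) (W j j),
     .arith .mul (T 1) (W i j) (W i j),
     .arith .add (T 0) (T 0) (T 1),
     .sqrt (T 0) (T 0),
     .arith .div (T 1) (W j j) (T 0),
     .arith .div (T 2) (W i j) (T 0)] ++
    (List.range 5).map (fun l => block
      [.arith .mul (T 3) (T 1) (W j l),
       .arith .mul (T 4) (T 2) (W i l),
       .arith .add (T 5) (T 3) (T 4),
       .arith .mul (T 3) (T 1) (W i l),
       .arith .mul (T 4) (T 2) (W j l),
       .arith .sub (W i l) (T 3) (T 4),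
       .copy (W j l) (T 5)])))

/-- Writes the row `α e_c` with right-hand side `α y` of the site `o` after the last one into
workspace row `i`, where `α = √p / δ`. -/
def loadSite (i c o : ℕ) : Prog Field := block (
  (List.range 5).map (fun l => .const (W i l) 0) ++
  [.sqrt (T 0) (.fixed .p 0),
   .arith .div (W i c) (T 0) (cur .δ o),
   .arith .mul (W i 4) (W i c) (cur .y o)])

/-- Writes the two rows `β [V W]` (right-hand side zero) of the interval between the last site and
the next one into the workspace rows `i` and `i + 1`, where `β = √(1 - p)`. -/
def loadInterval (i : ℕ) : Prog Field := block (
  (List.range 5).map (fun l => .const (W i l) 0) ++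
  (List.range 5).map (fun l => .const (W (i + 1) l) 0) ++
  [.const (T 0) 1,
   .arith .sub (T 0) (T 0) (.fixed .p 0),
   .sqrt (T 0) (T 0),
   .arith .sub (T 1) (cur .x 1) (cur .x 0),
   .sqrt (T 2) (T 1),
   .const (T 3) 3,
   .sqrt (T 3) (T 3),
   .arith .div (W (i + 1) 1) (T 0) (T 2),
   .arith .sub (W (i + 1) 3) (W (i + 1) 0) (W (i + 1) 1),
   .arith .mul (W i 1) (T 3) (W (i + 1) 1),
   .copy (W i 3) (W i 1),
   .const (T 4) 2,
   .arith .mul (T 5) (T 4) (W i 1),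
   .arith .div (W i 0) (T 5) (T 1),
   .arith .sub (W i 2) (W i 2) (W i 0)])

/-- Reads the last two rows of `[R | z]` into the workspace rows `0` and `1`. -/
def loadRows : Prog Field := block (
  (List.range 5).map (fun b => .copy (W 0 b) (cur (.R 0 b) 0)) ++
  (List.range 5).map (fun b => .copy (W 1 b) (cur (.R 1 b) 0)))

/-- Stores the first four workspace rows as the new last four rows of `[R | z]`. -/
def storeRows : Prog Field := block (
  (List.range 2).map (fun a => block (
    (List.range 5).map (fun b => .copy (cur (.R a b) 0) (W a b)))) ++
  (List.range 2).map (fun a => block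
    [.copy (cur (.R a 0) 1) (W (a + 2) 2),
     .copy (cur (.R a 1) 1) (W (a + 2) 3),
     .const (cur (.R a 2) 1) 0,
     .const (cur (.R a 3) 1) 0,
     .copy (cur (.R a 4) 1) (W (a + 2) 4)]))

/-- Initialization with the first two sites: QR decomposition of the `4 × 4` system, energy `0`. -/
def initTwo : Prog Field := block
  [loadSite 0 0 0,
   loadInterval 1,
   loadSite 3 2 1,
   rotate 0 1, rotate 0 2, rotate 0 3,
   rotate 1 2, rotate 1 3,
   rotate 2 3,
   storeRows,
   .const (cur .out 1) 0,
   .incIdx 1]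

/-- The update that adds one site: the last two rows of `[R | z]` and the three new rows form a
`5 × 4` system with right-hand side, which is triangularized by Givens rotations; the square of the
new residual entry is added to the energy. -/
def updateStep : Prog Field := block
  [loadRows,
   loadInterval 2,
   loadSite 4 2 1,
   rotate 0 1, rotate 0 2, rotate 0 3, rotate 0 4,
   rotate 1 2, rotate 1 3, rotate 1 4,
   rotate 2 3, rotate 2 4,
   rotate 3 4,
   storeRows,
   .copy (cur .res 1) (W 4 4),
   .arith .mul (T 0) (W 4 4) (W 4 4),
   .arith .add (cur .out 1) (cur .out 0) (T 0),
   .incIdx 1]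

/-- The part of the scheme before the updates: one site (energy `0`), then two sites if there are at
least two.  Register `2` is left at `N - 2` (truncated at `0`). -/
def startUp : Prog Field := block
  [.setIdx 1 0,
   .const (.fixed .out 0) 0,
   .copyIdx 2 0,
   .decIdx 2,
   .ifIdxZero 2 .skip initTwo,
   .decIdx 2]

/-- The complete update scheme. -/
def updateScheme : Prog Field := .seq startUp (.loop 2 updateStep)

/-- The initial state: the `N` data triples, the parameter `p` and the number `N` are given;
everything else is zero. -/
noncomputable def input (N : ℕ) (x y δ : ℕ → ℝ) (p : ℝ) : State Field where
  mem := fun c => match c with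
    | (.x, i) => if i < N then x i else 0
    | (.y, i) => if i < N then y i else 0
    | (.δ, i) => if i < N then δ i else 0
    | (.p, 0) => p
    | _ => 0
  idx := fun j => if j = 0 then N else 0
  steps := 0
  touched := ∅

/-- Memory contents during the run on `N` sites when `r ≥ 2` sites have been processed, that is,
after the initialization and `r - 2` updates. -/
noncomputable def memAfter (N : ℕ) (x y δ : ℕ → ℝ) (p : ℝ) (r : ℕ) : Field × ℕ → ℝ :=
  ((exec updateStep)^[r - 2] (exec startUp (input N x y δ p))).mem

/-! ## Spline energies -/

open Classical in
/-- The smoothing spline functional on `I` for the data at those sites that lie in `I`. -/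
noncomputable def splineFunctional (N : ℕ) (x y δ : ℕ → ℝ) (p : ℝ) (I : Set ℝ) (f : ℝ → ℝ) : ℝ :=
  p * ∑ i ∈ (Finset.range N).filter (fun i => x i ∈ I), ((y i - f (x i)) / δ i) ^ 2
    + (1 - p) * ∫ t in I, (iteratedDerivWithin 2 f I t) ^ 2

/-- `E` is the spline energy of `I`: the minimum of the functional over all `f ∈ C²(I)`.  (Functions
whose roughness integral is infinite have functional value `∞` and do not matter.) -/
def IsSplineEnergy (N : ℕ) (x y δ : ℕ → ℝ) (p : ℝ) (I : Set ℝ) (E : ℝ) : Prop :=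
  IsLeast (splineFunctional N x y δ p I ''
    {f | ContDiffOn ℝ 2 f I ∧
      MeasureTheory.IntegrableOn (fun t => (iteratedDerivWithin 2 f I t) ^ 2) I}) E

/-! ## The banded least squares system -/

/-- The weight `α_i` of a site. -/
noncomputable def alpha (δ : ℕ → ℝ) (p : ℝ) (i : ℕ) : ℝ := Real.sqrt p / δ i

/-- The weight `β` of the roughness rows. -/
noncomputable def beta (p : ℝ) : ℝ := Real.sqrt (1 - p)

/-- The factor `U = [V W]` with `‖U v‖² = ∫ (q'')²` for the cubic `q` on an interval of length `d`
with Hermite data `v = (q, q', q, q')` at the left and at the right end point. -/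
noncomputable def hermiteFactor (d : ℝ) : Matrix (Fin 2) (Fin 4) ℝ :=
  !![2 * Real.sqrt 3 / d ^ (3 / 2 : ℝ), Real.sqrt 3 / Real.sqrt d,
      -(2 * Real.sqrt 3 / d ^ (3 / 2 : ℝ)), Real.sqrt 3 / Real.sqrt d;
    0, 1 / Real.sqrt d, 0, -(1 / Real.sqrt d)]

/-- The matrix `A^{(r)}` of size `(3 r - 2) × 2 r`.  Row `3 m` is the data row `α_m e` of site `m`
in column `2 m`; the rows `3 m + 1` and `3 m + 2` are the rows `β [V_m W_m]` of the interval between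
the sites `m` and `m + 1`, in the columns `2 m, …, 2 m + 3`. -/
noncomputable def systemMatrix (x δ : ℕ → ℝ) (p : ℝ) (r : ℕ) :
    Matrix (Fin (3 * r - 2)) (Fin (2 * r)) ℝ :=
  Matrix.of fun i j =>
    if i.val % 3 = 0 then
      if j.val = 2 * (i.val / 3) then alpha δ p (i.val / 3) else 0
    else if h : 2 * (i.val / 3) ≤ j.val ∧ j.val < 2 * (i.val / 3) + 4 then
      beta p * hermiteFactor (x (i.val / 3 + 1) - x (i.val / 3))
        ⟨i.val % 3 - 1, by omega⟩ ⟨j.val - 2 * (i.val / 3), by omega⟩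
    else 0

/-- The right-hand side `ỹ^{(r)}`. -/
noncomputable def systemRhs (y δ : ℕ → ℝ) (p : ℝ) (r : ℕ) : Fin (3 * r - 2) → ℝ :=
  fun i => if i.val % 3 = 0 then alpha δ p (i.val / 3) * y (i.val / 3) else 0

/-- The matrix `R` for `r` sites held in band storage. -/
def storedR (mem : Field × ℕ → ℝ) (r : ℕ) : Matrix (Fin (3 * r - 2)) (Fin (2 * r)) ℝ :=
  Matrix.of fun i j =>
    if i.val < 2 * r ∧ 2 * (i.val / 2) ≤ j.val ∧ j.val < 2 * (i.val / 2) + 4 then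
      mem (.R (i.val % 2) (j.val - 2 * (i.val / 2)), i.val / 2)
    else 0

/-- The right-hand side `z` for `r` sites: `2 r` entries belonging to the rows of `R`, followed by
the residual entries of the sites `2, …, r - 1` (numbered from `0`). -/
def storedZ (mem : Field × ℕ → ℝ) (r : ℕ) : Fin (3 * r - 2) → ℝ :=
  fun i => if i.val < 2 * r then mem (.R (i.val % 2) 4, i.val / 2) else mem (.res, i.val - 2 * r + 2)

/-- `[R | z]` is a triangularization of `[A^{(r)} | ỹ^{(r)}]`: `A = Q R` and `z = Qᵀ ỹ` with `Q`
orthogonal and `R` upper triangular with zero rows below row `2 r`. -/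
def IsQRSystem (x y δ : ℕ → ℝ) (p : ℝ) (r : ℕ)
    (R : Matrix (Fin (3 * r - 2)) (Fin (2 * r)) ℝ) (z : Fin (3 * r - 2) → ℝ) : Prop :=
  (∀ i j, j.val < i.val → R i j = 0) ∧
  ∃ Q ∈ Matrix.orthogonalGroup (Fin (3 * r - 2)) ℝ,
    systemMatrix x δ p r = Q * R ∧ z = Q.transpose.mulVec (systemRhs y δ p r)

/-- The `5 × 4` subsystem with right-hand side on which the update from `r` to `r + 1` sites acts:
the last two rows of `[R | z]` and the three new rows, in the last two old and two new columns. -/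
noncomputable def smallSystem (x y δ : ℕ → ℝ) (p : ℝ) (r : ℕ) (mem : Field × ℕ → ℝ) :
    Matrix (Fin 5) (Fin 5) ℝ :=
  let k := r - 1
  let B := beta p • hermiteFactor (x r - x k)
  !![mem (.R 0 0, k), mem (.R 0 1, k), 0, 0, mem (.R 0 4, k);
    mem (.R 1 0, k), mem (.R 1 1, k), 0, 0, mem (.R 1 4, k);
    B 0 0, B 0 1, B 0 2, B 0 3, 0;
    B 1 0, B 1 1, B 1 2, B 1 3, 0;
    0, 0, alpha δ p r, 0, alpha δ p r * y r]

/-- The same rows and columns as stored after the update: four rows of the new `[R | z]` and the row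
that has become zero on the left, whose right-hand side is the new residual entry. -/
def reducedSystem (r : ℕ) (mem : Field × ℕ → ℝ) : Matrix (Fin 5) (Fin 5) ℝ :=
  let k := r - 1
  !![mem (.R 0 0, k), mem (.R 0 1, k), mem (.R 0 2, k), mem (.R 0 3, k), mem (.R 0 4, k);
    mem (.R 1 0, k), mem (.R 1 1, k), mem (.R 1 2, k), mem (.R 1 3, k), mem (.R 1 4, k);
    0, 0, mem (.R 0 0, r), mem (.R 0 1, r), mem (.R 0 4, r);
    0, 0, mem (.R 1 0, r), mem (.R 1 1, r), mem (.R 1 4, r);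
    0, 0, 0, 0, mem (.res, r)]

/-- Givens rotations: rotations of a coordinate plane. -/
def IsGivensRotation (G : Matrix (Fin 5) (Fin 5) ℝ) : Prop :=
  ∃ (i j : Fin 5) (c s : ℝ), i ≠ j ∧ c ^ 2 + s ^ 2 = 1 ∧
    G = Matrix.of fun a b =>
      if a = i ∧ b = i then c
      else if a = i ∧ b = j then s
      else if a = j ∧ b = i then -s
      else if a = j ∧ b = j then c
      else if a = b then 1 else 0

end CSSD

/-!
The program keeps the pair `[R | z]` obtained from the banded least squares system `[A | ỹ]` by
rotations, and two facts about it give everything.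

*The triangularization.* A Givens rotation does not change the Euclidean norm, so after every update
`‖R v + t z‖ = ‖A v + t ỹ‖` for all unknowns `v` and all scalars `t`. Both sides are sums over rows,
so adding a site changes them only by the rows of the small system on which the update acts, and the
identity passes from `r` to `r + 1` sites (`storedNorm_eq_of_init`, `storedNorm_eq_of_update`). The
orthogonal factor `Q` need not be assembled from the rotations: two linear maps into a Euclidean
space with equal norms differ by an isometry on the range, and this isometry extends to the whole
space (`exists_orthogonal_of_sum_sq_eq`). That the program performs these rotations and leaves a
triangular workspace is `Ready.update` and `exec_initTwo_spec`; cells and registers are followed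
through the program by the arrays it writes to (`WritesIn.mem_exec`) and by a description of the
`5 × 5` workspace as a matrix (`wsMat_exec_rotate`).

*The energies.* On an interval of length `d`, the roughness `∫ (f'')²` is at least the squared norm
of the projection of `f''` to the affine functions, which partial integration expresses by the
Hermite data of `f` at the end points (`hermiteEnergy_le_integral`); this is the squared norm of the
rows `[V W]`. Hence the least squares functional at the Hermite data of `f` is a lower bound of the
spline functional of `f`, and its minimum is the sum of the squared residual entries, since `A` is
injective and the triangular system can be solved. A minimizer is stationary in the slopes, which
says precisely that the second derivatives of adjacent cubic pieces agree and vanish at both ends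
(`exists_moments_of_minimizer`). So the cubic pieces form a natural spline, written with truncated
powers in `exists_natural_spline`; extended by straight lines it is `C²` on every interval and
attains the bound.

For the costs, loop-free programs take boundedly many steps, and each step touches at most three
cells (`LoopFree.exists_steps_le`, `touched_card_exec_le`).
-/

namespace CSSD

/-! ### Costs and frames of programs -/

/-- Programs without loops. -/
def LoopFree {F : Type} : Prog F → Prop
  | .seq P Q => LoopFree P ∧ LoopFree Q
  | .ifZero _ P Q => LoopFree P ∧ LoopFree Q
  | .ifIdxZero _ P Q => LoopFree P ∧ LoopFree Q
  | .loop _ _ => False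
  | _ => True

theorem loopFree_block {F : Type} {L : List (Prog F)} (h : ∀ P ∈ L, LoopFree P) :
    LoopFree (block L) := by
  induction L with
  | nil => trivial
  | cons P L ih =>
    exact ⟨h P (by simp), ih fun Q hQ => h Q (by simp [hQ])⟩

theorem LoopFree.exists_steps_le {F : Type} [DecidableEq F] {P : Prog F} (h : LoopFree P) :
    ∃ K, ∀ s : State F, (exec P s).steps ≤ s.steps + K := by
  induction P with
  | seq P Q hP hQ =>
    obtain ⟨K, hK⟩ := hP h.1
    obtain ⟨K', hK'⟩ := hQ h.2
    refine ⟨K + K', fun s => ?_⟩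
    have h1 := hK s
    have h2 := hK' (exec P s)
    simp only [exec]
    omega
  | ifZero a P Q hP hQ =>
    obtain ⟨K, hK⟩ := hP h.1
    obtain ⟨K', hK'⟩ := hQ h.2
    refine ⟨K + K' + 1, fun s => ?_⟩
    simp only [exec]
    split_ifs
    · refine (hK _).trans ?_
      simp only [State.tick]
      omega
    · refine (hK' _).trans ?_
      simp only [State.tick]
      omega
  | ifIdxZero a P Q hP hQ =>
    obtain ⟨K, hK⟩ := hP h.1
    obtain ⟨K', hK'⟩ := hQ h.2
    refine ⟨K + K' + 1, fun s => ?_⟩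
    simp only [exec]
    split_ifs
    · refine (hK _).trans ?_
      simp only [State.tick]
      omega
    · refine (hK' _).trans ?_
      simp only [State.tick]
      omega
  | loop j P _ => exact h.elim
  | _ => exact ⟨1, fun s => by simp [exec, State.assign, State.assignIdx]⟩

theorem iterate_steps_le {F : Type} {f : State F → State F} {K : ℕ}
    (h : ∀ s, (f s).steps ≤ s.steps + K) (n : ℕ) (s : State F) :
    (f^[n] s).steps ≤ s.steps + n * K := by
  induction n generalizing s with
  | zero => simp
  | succ n ih =>
    rw [Function.iterate_succ_apply]
    have h1 := ih (f s)
    have h2 := h s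
    have h3 : (n + 1) * K = n * K + K := by ring
    omega

/-- Every step reads or writes at most three cells. -/
theorem touched_card_exec_le {F : Type} [DecidableEq F] (P : Prog F) (s : State F)
    (h : s.touched.card ≤ 3 * s.steps) :
    (exec P s).touched.card ≤ 3 * (exec P s).steps := by
  have assign_le : ∀ (s : State F) (dst : Addr F) (srcs : List (Addr F)) (v : ℝ),
      s.touched.card ≤ 3 * s.steps → srcs.length ≤ 2 →
      (s.assign dst srcs v).touched.card ≤ 3 * (s.assign dst srcs v).steps := by
    intro s dst srcs v hs hl
    simp only [State.assign]
    refine (Finset.card_union_le _ _).trans ?_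
    have h1 := List.toFinset_card_le ((dst :: srcs).map (fun a => a.cell s))
    simp only [List.length_map, List.length_cons] at h1
    omega
  induction P generalizing s with
  | skip => exact h
  | const dst c => exact assign_le _ _ _ _ h (by simp)
  | copy dst src => exact assign_le _ _ _ _ h (by simp)
  | arith op dst a b => exact assign_le _ _ _ _ h (by simp)
  | sqrt dst a => exact assign_le _ _ _ _ h (by simp)
  | setIdx j c => simp only [exec, State.assignIdx]; omega
  | copyIdx j c => simp only [exec, State.assignIdx]; omega
  | incIdx j => simp only [exec, State.assignIdx]; omega
  | decIdx j => simp only [exec, State.assignIdx]; omega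
  | seq P Q hP hQ => exact hQ _ (hP _ h)
  | ifZero a P Q hP hQ =>
    simp only [exec]
    have h1 : (insert (a.cell s) s.touched).card ≤ 3 * (s.tick 1).steps := by
      refine (Finset.card_insert_le _ _).trans ?_
      simp only [State.tick]
      omega
    split_ifs
    · exact hP _ h1
    · exact hQ _ h1
  | ifIdxZero j P Q hP hQ =>
    simp only [exec]
    have h1 : (s.tick 1).touched.card ≤ 3 * (s.tick 1).steps := by
      simp only [State.tick]
      omega
    split_ifs
    · exact hP _ h1
    · exact hQ _ h1
  | loop j P hP =>
    simp only [exec]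
    have h1 : ∀ (n : ℕ) (t : State F), t.touched.card ≤ 3 * t.steps →
        ((exec P)^[n] t).touched.card ≤ 3 * ((exec P)^[n] t).steps := by
      intro n
      induction n with
      | zero => exact fun t ht => ht
      | succ n ih =>
        intro t ht
        rw [Function.iterate_succ_apply]
        exact ih _ (hP _ ht)
    refine h1 _ _ ?_
    simp only [State.tick]
    omega

/-- The array an address belongs to. -/
def Addr.field {F : Type} : Addr F → F
  | .fixed f _ => f
  | .rel f _ _ => f

theorem Addr.cell_fst {F : Type} (a : Addr F) (s : State F) : (a.cell s).1 = a.field := by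
  cases a <;> rfl

/-- `WritesIn φ P`: every array the program `P` writes to satisfies `φ`. -/
def WritesIn {F : Type} (φ : F → Prop) : Prog F → Prop
  | .const dst _ => φ dst.field
  | .copy dst _ => φ dst.field
  | .arith _ dst _ _ => φ dst.field
  | .sqrt dst _ => φ dst.field
  | .seq P Q => WritesIn φ P ∧ WritesIn φ Q
  | .ifZero _ P Q => WritesIn φ P ∧ WritesIn φ Q
  | .ifIdxZero _ P Q => WritesIn φ P ∧ WritesIn φ Q
  | .loop _ P => WritesIn φ P
  | _ => True

theorem writesIn_block {F : Type} {φ : F → Prop} {L : List (Prog F)} :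
    WritesIn φ (block L) ↔ ∀ P ∈ L, WritesIn φ P := by
  induction L with
  | nil => simp [block, WritesIn]
  | cons P L ih => simp [block, WritesIn, ih]

theorem WritesIn.mem_exec {F : Type} [DecidableEq F] {φ : F → Prop} {P : Prog F} (h : WritesIn φ P)
    (s : State F) {c : F × ℕ} (hc : ¬ φ c.1) : (exec P s).mem c = s.mem c := by
  have key : ∀ (s : State F) (dst : Addr F) (srcs : List (Addr F)) (v : ℝ), φ dst.field →
      (s.assign dst srcs v).mem c = s.mem c := by
    intro s dst srcs v hd
    simp only [State.assign]
    refine Function.update_of_ne ?_ _ _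
    rintro rfl
    exact hc (by rwa [Addr.cell_fst])
  induction P generalizing s with
  | skip | setIdx | copyIdx | incIdx | decIdx => rfl
  | const dst c => exact key _ _ _ _ h
  | copy dst src => exact key _ _ _ _ h
  | arith op dst a b => exact key _ _ _ _ h
  | sqrt dst a => exact key _ _ _ _ h
  | seq P Q hP hQ => exact (hQ h.2 _).trans (hP h.1 _)
  | ifZero a P Q hP hQ =>
    simp only [exec]
    split_ifs
    · exact hP h.1 _
    · exact hQ h.2 _
  | ifIdxZero a P Q hP hQ =>
    simp only [exec]
    split_ifs
    · exact hP h.1 _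
    · exact hQ h.2 _
  | loop j P hP =>
    simp only [exec]
    have h1 : ∀ (n : ℕ) (t : State F), ((exec P)^[n] t).mem c = t.mem c := by
      intro n
      induction n with
      | zero => exact fun t => rfl
      | succ n ih =>
        intro t
        rw [Function.iterate_succ_apply, ih, hP h]
    exact h1 _ _

/-- Programs that do not change any index register. -/
def KeepsIdx {F : Type} : Prog F → Prop
  | .setIdx _ _ => False
  | .copyIdx _ _ => False
  | .incIdx _ => False
  | .decIdx _ => False
  | .seq P Q => KeepsIdx P ∧ KeepsIdx Q
  | .ifZero _ P Q => KeepsIdx P ∧ KeepsIdx Q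
  | .ifIdxZero _ P Q => KeepsIdx P ∧ KeepsIdx Q
  | .loop _ _ => False
  | _ => True

theorem keepsIdx_block {F : Type} {L : List (Prog F)} :
    KeepsIdx (block L) ↔ ∀ P ∈ L, KeepsIdx P := by
  induction L with
  | nil => simp [block, KeepsIdx]
  | cons P L ih => simp [block, KeepsIdx, ih]

theorem KeepsIdx.idx_exec {F : Type} [DecidableEq F] {P : Prog F} (h : KeepsIdx P) (s : State F) :
    (exec P s).idx = s.idx := by
  induction P generalizing s with
  | skip | const | copy | arith | sqrt => rfl
  | setIdx | copyIdx | incIdx | decIdx | loop => exact h.elim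
  | seq P Q hP hQ => exact (hQ h.2 _).trans (hP h.1 _)
  | ifZero a P Q hP hQ =>
    simp only [exec]
    split_ifs
    · exact hP h.1 _
    · exact hQ h.2 _
  | ifIdxZero a P Q hP hQ =>
    simp only [exec]
    split_ifs
    · exact hP h.1 _
    · exact hQ h.2 _

/-! ### Givens rotations of the workspace -/

/-- The arrays used for intermediate results only. -/
def IsScratch : Field → Prop
  | .ws _ _ => True
  | .tmp => True
  | _ => False

/-- The `5 × 5` workspace as a matrix; column `4` is the right-hand side. -/
def wsMat (s : State Field) : Matrix (Fin 5) (Fin 5) ℝ :=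
  Matrix.of fun a b => s.mem (.ws a b, 0)

/-- The rotation of the coordinate plane `(i, j)` with cosine `c` and sine `s`. -/
def givens (i j : Fin 5) (c s : ℝ) : Matrix (Fin 5) (Fin 5) ℝ :=
  Matrix.of fun a b =>
      if a = i ∧ b = i then c
      else if a = i ∧ b = j then s
      else if a = j ∧ b = i then -s
      else if a = j ∧ b = j then c
      else if a = b then 1 else 0

theorem givens_mul_apply {i j : Fin 5} (hij : i ≠ j) (c s : ℝ) (M : Matrix (Fin 5) (Fin 5) ℝ)
    (a b : Fin 5) :
    (givens i j c s * M) a b =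
      if a = i then c * M i b + s * M j b else if a = j then c * M j b - s * M i b else M a b := by
  rw [Matrix.mul_apply]
  have h : ∀ k, givens i j c s a k * M k b =
      (if k = i then (if a = i then c else if a = j then -s else 0) * M i b else 0) +
      (if k = j then (if a = i then s else if a = j then c else 0) * M j b else 0) +
      (if k = a then (if a = i then 0 else if a = j then 0 else 1) * M a b else 0) := by
    intro k
    simp only [givens, Matrix.of_apply]
    by_cases h1 : a = i <;> by_cases h2 : a = j <;> by_cases h3 : k = i <;> by_cases h4 : k = j <;>
      by_cases h5 : k = a <;> subst_vars <;> simp_all [eq_comm]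
  simp only [h, Finset.sum_add_distrib, Finset.sum_ite_eq', Finset.mem_univ, if_true]
  by_cases h1 : a = i
  · simp [h1]
  · by_cases h2 : a = j
    · subst h2
      simp [h1]
      ring
    · simp [h1, h2]

/-- The rotation that `rotate j i` applies to the workspace `M`; if the entry `(i, j)` is already
zero, the program does nothing, which is the rotation by the angle zero. -/
noncomputable def annihilator (j i : Fin 5) (M : Matrix (Fin 5) (Fin 5) ℝ) :
    Matrix (Fin 5) (Fin 5) ℝ :=
  if M i j = 0 then givens j i 1 0 else
    givens j i (M j j / √(M j j * M j j + M i j * M i j)) (M i j / √(M j j * M j j + M i j * M i j))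

theorem isGivensRotation_annihilator {j i : Fin 5} (h : j ≠ i) (M : Matrix (Fin 5) (Fin 5) ℝ) :
    IsGivensRotation (annihilator j i M) := by
  unfold annihilator
  split_ifs with h0
  · exact ⟨j, i, 1, 0, h, by norm_num, rfl⟩
  · refine ⟨j, i, _, _, h, ?_, rfl⟩
    have h1 : 0 < M j j * M j j + M i j * M i j :=
      add_pos_of_nonneg_of_pos (mul_self_nonneg _) (mul_self_pos.mpr h0)
    rw [div_pow, div_pow, Real.sq_sqrt h1.le, ← add_div]
    rw [div_eq_one_iff_eq h1.ne']
    ring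

/-- The part of a rotation that acts on one column of the workspace; the cosine and the sine are
kept in the temporaries `1` and `2`. -/
def rotateColumn (j i l : ℕ) : Prog Field := block
  [.arith .mul (T 3) (T 1) (W j l),
   .arith .mul (T 4) (T 2) (W i l),
   .arith .add (T 5) (T 3) (T 4),
   .arith .mul (T 3) (T 1) (W i l),
   .arith .mul (T 4) (T 2) (W j l),
   .arith .sub (W i l) (T 3) (T 4),
   .copy (W j l) (T 5)]

theorem State.mem_assign {F : Type} [DecidableEq F] (s : State F) (dst : Addr F)
    (srcs : List (Addr F)) (v : ℝ) (c : F × ℕ) :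
    (s.assign dst srcs v).mem c = if c = dst.cell s then v else s.mem c :=
  Function.update_apply _ _ _ _

theorem State.idx_assign {F : Type} [DecidableEq F] (s : State F) (dst : Addr F)
    (srcs : List (Addr F)) (v : ℝ) : (s.assign dst srcs v).idx = s.idx := rfl

theorem mem_tmp_exec_rotateColumn (j i l : ℕ) (s : State Field) {m : ℕ} (hm : m < 3) :
    (exec (rotateColumn j i l) s).mem (.tmp, m) = s.mem (.tmp, m) := by
  have : m ≠ 3 ∧ m ≠ 4 ∧ m ≠ 5 := by omega
  simp [rotateColumn, block, exec, State.mem_assign, State.read, Addr.cell, T, W, this]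

theorem mem_ws_exec_rotateColumn (j i l : ℕ) (s : State Field) (a b : ℕ) :
    (exec (rotateColumn j i l) s).mem (.ws a b, 0) =
      if a = j ∧ b = l then
        s.mem (.tmp, 1) * s.mem (.ws j l, 0) + s.mem (.tmp, 2) * s.mem (.ws i l, 0)
      else if a = i ∧ b = l then
        s.mem (.tmp, 1) * s.mem (.ws i l, 0) - s.mem (.tmp, 2) * s.mem (.ws j l, 0)
      else s.mem (.ws a b, 0) := by
  simp only [rotateColumn, block, exec, State.mem_assign, State.read, Addr.cell, T, W, Arith.eval,
    Prod.mk.injEq, Field.ws.injEq, reduceCtorEq, and_true, and_false,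
    if_false, if_true, Nat.reduceEqDiff]

theorem mem_ws_exec_rotateColumns (j i : ℕ) (L : List ℕ) (hL : L.Nodup)
    (s : State Field) (a b : ℕ) :
    (exec (block (L.map (rotateColumn j i))) s).mem (.ws a b, 0) =
      if a = j ∧ b ∈ L then
        s.mem (.tmp, 1) * s.mem (.ws j b, 0) + s.mem (.tmp, 2) * s.mem (.ws i b, 0)
      else if a = i ∧ b ∈ L then
        s.mem (.tmp, 1) * s.mem (.ws i b, 0) - s.mem (.tmp, 2) * s.mem (.ws j b, 0)
      else s.mem (.ws a b, 0) := by
  induction L generalizing s with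
  | nil => simp [block, exec]
  | cons l L ih =>
    rw [List.nodup_cons] at hL
    simp only [List.map_cons, block, exec, ih hL.2, mem_ws_exec_rotateColumn,
      mem_tmp_exec_rotateColumn j i l s (show 1 < 3 by norm_num),
      mem_tmp_exec_rotateColumn j i l s (show 2 < 3 by norm_num)]
    by_cases hb : b = l
    · subst hb
      simp [hL.1]
    · simp [hb]

theorem exec_block_append {F : Type} [DecidableEq F] (L L' : List (Prog F)) (s : State F) :
    exec (block (L ++ L')) s = exec (block L') (exec (block L) s) := by
  induction L generalizing s with
  | nil => rfl
  | cons P L ih => exact ih _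

theorem wsMat_exec_rotate {j i : Fin 5} (h : j ≠ i) (s : State Field) :
    wsMat (exec (rotate j i) s) = annihilator j i (wsMat s) * wsMat s := by
  ext a b
  unfold annihilator
  rw [apply_ite (fun G : Matrix (Fin 5) (Fin 5) ℝ => (G * wsMat s) a b)]
  rw [givens_mul_apply h, givens_mul_apply h]
  by_cases h0 : wsMat s i j = 0
  · have h0' : s.mem (.ws i j, 0) = 0 := h0
    simp only [rotate, exec, State.read, W, Addr.cell, h0, h0', if_true]
    by_cases ha : a = j
    · simp [wsMat, ha, State.tick]
    · by_cases ha' : a = i <;> simp [wsMat, ha, ha', State.tick, h.symm]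
  · have h0' : s.mem (.ws i j, 0) ≠ 0 := h0
    rw [if_neg h0]
    have hexec : ∃ t : State Field, exec (rotate j i) s =
        exec (block ((List.range 5).map (rotateColumn j i))) t ∧
        (∀ a b, t.mem (.ws a b, 0) = s.mem (.ws a b, 0)) ∧
        t.mem (.tmp, 1) = wsMat s j j / √(wsMat s j j * wsMat s j j + wsMat s i j * wsMat s i j) ∧
        t.mem (.tmp, 2) =
          wsMat s i j / √(wsMat s j j * wsMat s j j + wsMat s i j * wsMat s i j) := by
      simp only [rotate, exec, State.read, W, Addr.cell, h0', if_false, exec_block_append]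
      refine ⟨_, rfl, ?_, ?_, ?_⟩
      · intro a b
        simp [block, exec, State.assign, State.read, Addr.cell, T, State.tick]
      · simp [block, exec, State.assign, State.read, Addr.cell, T, State.tick, Arith.eval, wsMat]
      · simp [block, exec, State.assign, State.read, Addr.cell, T, State.tick, Arith.eval, wsMat]
    obtain ⟨t, ht, h1, h2, h3⟩ := hexec
    have hb : (b : ℕ) ∈ List.range 5 := List.mem_range.mpr b.isLt
    simp only [wsMat, Matrix.of_apply] at h2 h3 ⊢
    rw [ht, mem_ws_exec_rotateColumns _ _ _ List.nodup_range, h1, h1, h1, h2, h3]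
    simp only [hb, and_true, Fin.val_inj]

/-- The workspace after the rotation that annihilates the entry `(i, j)`. -/
noncomputable def rotated (j i : Fin 5) (M : Matrix (Fin 5) (Fin 5) ℝ) :
    Matrix (Fin 5) (Fin 5) ℝ :=
  annihilator j i M * M

/-- The rotations in the coordinate planes listed in `L`, each chosen for the current workspace. -/
noncomputable def sweep (L : List (Fin 5 × Fin 5)) (M : Matrix (Fin 5) (Fin 5) ℝ) :
    Matrix (Fin 5) (Fin 5) ℝ :=
  L.foldl (fun M q => rotated q.1 q.2 M) M

theorem wsMat_exec_rotations {L : List (Fin 5 × Fin 5)} (hL : ∀ q ∈ L, q.1 ≠ q.2)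
    (s : State Field) :
    wsMat (exec (block (L.map fun q => rotate q.1 q.2)) s) = sweep L (wsMat s) := by
  induction L generalizing s with
  | nil => rfl
  | cons q L ih =>
    simp only [List.map_cons, block, exec, sweep, List.foldl_cons]
    rw [ih fun q' hq' => hL q' (by simp [hq']), wsMat_exec_rotate (hL q (by simp))]
    rfl

theorem exists_sweep_eq_prod_mul {L : List (Fin 5 × Fin 5)} (hL : ∀ q ∈ L, q.1 ≠ q.2)
    (M : Matrix (Fin 5) (Fin 5) ℝ) :
    ∃ G : List (Matrix (Fin 5) (Fin 5) ℝ), G.length = L.length ∧ (∀ g ∈ G, IsGivensRotation g) ∧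
      sweep L M = G.prod * M := by
  induction L generalizing M with
  | nil => exact ⟨[], rfl, by simp, by simp [sweep]⟩
  | cons q L ih =>
    obtain ⟨G, hG, hG', h⟩ := ih (fun q' hq' => hL q' (by simp [hq'])) (rotated q.1 q.2 M)
    refine ⟨G ++ [annihilator q.1 q.2 M], by simp [hG], ?_, ?_⟩
    · intro g hg
      rw [List.mem_append, List.mem_singleton] at hg
      rcases hg with hg | rfl
      · exact hG' g hg
      · exact isGivensRotation_annihilator (hL q (by simp)) M
    · rw [List.prod_append, List.prod_singleton, Matrix.mul_assoc]
      exact h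

theorem IsGivensRotation.sum_sq_mulVec {G : Matrix (Fin 5) (Fin 5) ℝ} (hG : IsGivensRotation G)
    (u : Fin 5 → ℝ) : ∑ a, (G.mulVec u a) ^ 2 = ∑ a, u a ^ 2 := by
  obtain ⟨i, j, c, s, hij, hcs, rfl⟩ := hG
  change ∑ a, ((givens i j c s).mulVec u a) ^ 2 = _
  have h : ∀ a, (givens i j c s).mulVec u a =
      if a = i then c * u i + s * u j else if a = j then c * u j - s * u i else u a := by
    intro a
    have h1 := givens_mul_apply hij c s (Matrix.of fun k _ => u k) a 0
    simpa [Matrix.mul_apply, Matrix.mulVec, dotProduct] using h1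
  have h2 : ∀ a, ((givens i j c s).mulVec u a) ^ 2 = u a ^ 2 +
      ((if a = i then (c * u i + s * u j) ^ 2 - u i ^ 2 else 0) +
        (if a = j then (c * u j - s * u i) ^ 2 - u j ^ 2 else 0)) := by
    intro a
    rw [h]
    by_cases h3 : a = i
    · simp [h3, hij]
    · by_cases h4 : a = j
      · simp [h4, hij.symm]
      · simp [h3, h4]
  simp only [h2, Finset.sum_add_distrib, Finset.sum_ite_eq', Finset.mem_univ, if_true]
  linear_combination (u i ^ 2 + u j ^ 2) * hcs

theorem sum_sq_mulVec_of_givens_prod {L : List (Matrix (Fin 5) (Fin 5) ℝ)}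
    (hL : ∀ G ∈ L, IsGivensRotation G) (u : Fin 5 → ℝ) :
    ∑ a, (L.prod.mulVec u a) ^ 2 = ∑ a, u a ^ 2 := by
  induction L with
  | nil => simp
  | cons G L ih =>
    rw [List.prod_cons, ← Matrix.mulVec_mulVec, (hL G (by simp)).sum_sq_mulVec,
      ih fun g hg => hL g (by simp [hg])]

theorem sweep_row_eq {L : List (Fin 5 × Fin 5)} (hL : ∀ q ∈ L, q.1 ≠ q.2) {a : Fin 5}
    (ha : ∀ q ∈ L, a ≠ q.1 ∧ a ≠ q.2) (M : Matrix (Fin 5) (Fin 5) ℝ) (b : Fin 5) :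
    sweep L M a b = M a b := by
  induction L generalizing M with
  | nil => rfl
  | cons q L ih =>
    have h1 := ha q (by simp)
    refine (ih (fun q' hq' => hL q' (by simp [hq'])) (fun q' hq' => ha q' (by simp [hq']))
      _).trans ?_
    simp only [rotated, annihilator]
    split_ifs <;> simp [givens_mul_apply (hL q (by simp)), h1.1, h1.2]

/-- The entries below the diagonal of the rows above row `n` vanish in the columns before `j`, and
in column `j` above row `i`. -/
def Cleared (n j i : ℕ) (M : Matrix (Fin 5) (Fin 5) ℝ) : Prop :=
  ∀ a b : Fin 5, a.val < n → b < a → b.val < j ∨ b.val = j ∧ a.val < i → M a b = 0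

theorem Cleared.next_column {n j : ℕ} {M : Matrix (Fin 5) (Fin 5) ℝ} (h : Cleared n j n M) :
    Cleared n (j + 1) (j + 2) M := by
  intro a b ha hb hab
  refine h a b ha hb ?_
  have : b.val < a.val := hb
  omega

theorem Cleared.rotated {n : ℕ} {j i : Fin 5} (hij : j < i) (hi : i.val < n)
    {M : Matrix (Fin 5) (Fin 5) ℝ} (h : Cleared n j i M) :
    Cleared n j (i.val + 1) (CSSD.rotated j i M) := by
  intro a b ha hb hab
  have hij' : j.val < i.val := hij
  have hb' : b.val < a.val := hb
  unfold CSSD.rotated annihilator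
  by_cases h1 : a = j
  · have hbj : b.val < j.val := by subst h1; omega
    have e1 : M j b = 0 := h j b (by omega) hbj (Or.inl hbj)
    have e2 : M i b = 0 := h i b hi (show b.val < i.val by omega) (Or.inl hbj)
    split_ifs <;> simp [givens_mul_apply hij.ne, h1, e1, e2]
  by_cases h2 : a = i
  · subst h2
    by_cases hbj : b.val < j.val
    · have e1 : M j b = 0 := h j b (by omega) hbj (Or.inl hbj)
      have e2 : M a b = 0 := h a b hi hb (Or.inl hbj)
      split_ifs <;> simp [givens_mul_apply hij.ne, h1, e1, e2]
    · have hbj' : b = j := Fin.ext (by omega)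
      subst hbj'
      split_ifs with h0
      · simp [givens_mul_apply hij.ne, h1, h0]
      · simp only [givens_mul_apply hij.ne, h1, if_false, if_true]
        ring
  · have h2' : a.val ≠ i.val := fun h' => h2 (Fin.ext h')
    have e : M a b = 0 := h a b ha hb (by omega)
    split_ifs <;> simp [givens_mul_apply hij.ne, h1, h2, e]

/-- The planes of the rotations that triangularize four rows. -/
def planesFour : List (Fin 5 × Fin 5) := [(0, 1), (0, 2), (0, 3), (1, 2), (1, 3), (2, 3)]

/-- The planes of the rotations that triangularize five rows. -/
def planesFive : List (Fin 5 × Fin 5) :=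
  [(0, 1), (0, 2), (0, 3), (0, 4), (1, 2), (1, 3), (1, 4), (2, 3), (2, 4), (3, 4)]

theorem cleared_zero_one (n : ℕ) (M : Matrix (Fin 5) (Fin 5) ℝ) : Cleared n 0 1 M := by
  intro a b _ hb hab
  have : b.val < a.val := hb
  omega

theorem cleared_sweep_planesFour (M : Matrix (Fin 5) (Fin 5) ℝ) :
    Cleared 4 3 4 (sweep planesFour M) := by
  have h := cleared_zero_one 4 M
  replace h := h.rotated (j := 0) (i := 1) (by decide) (by decide)
  replace h := h.rotated (j := 0) (i := 2) (by decide) (by decide)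
  replace h := h.rotated (j := 0) (i := 3) (by decide) (by decide)
  replace h := h.next_column
  replace h := h.rotated (j := 1) (i := 2) (by decide) (by decide)
  replace h := h.rotated (j := 1) (i := 3) (by decide) (by decide)
  replace h := h.next_column
  replace h := h.rotated (j := 2) (i := 3) (by decide) (by decide)
  simpa [sweep, planesFour] using h.next_column

theorem cleared_sweep_planesFive (M : Matrix (Fin 5) (Fin 5) ℝ) :
    Cleared 5 4 5 (sweep planesFive M) := by
  have h := cleared_zero_one 5 M
  replace h := h.rotated (j := 0) (i := 1) (by decide) (by decide)
  replace h := h.rotated (j := 0) (i := 2) (by decide) (by decide)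
  replace h := h.rotated (j := 0) (i := 3) (by decide) (by decide)
  replace h := h.rotated (j := 0) (i := 4) (by decide) (by decide)
  replace h := h.next_column
  replace h := h.rotated (j := 1) (i := 2) (by decide) (by decide)
  replace h := h.rotated (j := 1) (i := 3) (by decide) (by decide)
  replace h := h.rotated (j := 1) (i := 4) (by decide) (by decide)
  replace h := h.next_column
  replace h := h.rotated (j := 2) (i := 3) (by decide) (by decide)
  replace h := h.rotated (j := 2) (i := 4) (by decide) (by decide)
  replace h := h.next_column
  replace h := h.rotated (j := 3) (i := 4) (by decide) (by decide)
  simpa [sweep, planesFive] using h.next_column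

/-! ### Loading and storing -/

theorem mem_exec_loadSite_row {i c o : ℕ} (hc : c < 4) (s : State Field) {b : ℕ} (hb : b < 5) :
    (exec (loadSite i c o) s).mem (.ws i b, 0) =
      if b = c then alpha (fun n => s.mem (.δ, n)) (s.mem (.p, 0)) (s.idx 1 + o)
      else if b = 4 then alpha (fun n => s.mem (.δ, n)) (s.mem (.p, 0)) (s.idx 1 + o) *
        s.mem (.y, s.idx 1 + o)
      else 0 := by
  have hr : List.range 5 = [0, 1, 2, 3, 4] := rfl
  interval_cases c <;> interval_cases b <;>
    simp [loadSite, hr, block, exec, State.mem_assign, State.idx_assign, State.read, Addr.cell,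
      T, W, cur, Arith.eval,
      alpha]

theorem mem_exec_loadSite_of_ne {i c o : ℕ} (s : State Field) {f : Field} {k : ℕ}
    (hf : f ≠ .tmp) (hf' : ∀ b, f ≠ .ws i b) :
    (exec (loadSite i c o) s).mem (f, k) = s.mem (f, k) := by
  refine WritesIn.mem_exec (φ := fun f => f = .tmp ∨ ∃ b, f = .ws i b) ?_ s ?_
  · simp [loadSite, writesIn_block, WritesIn, Addr.field, T, W, List.range_succ]
  · rintro (h | ⟨b, h⟩)
    · exact hf h
    · exact hf' b h

theorem rpow_three_halves {d : ℝ} (hd : 0 ≤ d) : d ^ (3 / 2 : ℝ) = √d * d := by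
  rw [show (3 / 2 : ℝ) = 1 / 2 + 1 by norm_num, Real.rpow_add' hd (by norm_num), Real.rpow_one,
    Real.sqrt_eq_rpow]

theorem mem_exec_loadInterval_rows {i : ℕ} (s : State Field)
    (hd : s.mem (.x, s.idx 1) < s.mem (.x, s.idx 1 + 1)) :
    (∀ b : Fin 4, (exec (loadInterval i) s).mem (.ws i b, 0) = beta (s.mem (.p, 0)) *
      hermiteFactor (s.mem (.x, s.idx 1 + 1) - s.mem (.x, s.idx 1)) 0 b) ∧
    (exec (loadInterval i) s).mem (.ws i 4, 0) = 0 ∧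
    (∀ b : Fin 4, (exec (loadInterval i) s).mem (.ws (i + 1) b, 0) = beta (s.mem (.p, 0)) *
      hermiteFactor (s.mem (.x, s.idx 1 + 1) - s.mem (.x, s.idx 1)) 1 b) ∧
    (exec (loadInterval i) s).mem (.ws (i + 1) 4, 0) = 0 := by
  have hr : List.range 5 = [0, 1, 2, 3, 4] := rfl
  have h3 := rpow_three_halves (sub_pos.mpr hd).le
  set d := s.mem (.x, s.idx 1 + 1) - s.mem (.x, s.idx 1) with hd'
  refine ⟨?_, ?_, ?_, ?_⟩
  · intro b
    fin_cases b <;>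
      simp [loadInterval, hr, block, exec, State.mem_assign, State.idx_assign, State.read,
        Addr.cell, T, W, cur, Arith.eval, beta, hermiteFactor, h3, ← hd'] <;> ring_nf
  · simp [loadInterval, hr, block, exec, State.mem_assign, State.idx_assign, State.read,
      Addr.cell, T, W, cur]
  · intro b
    fin_cases b <;>
      simp [loadInterval, hr, block, exec, State.mem_assign, State.idx_assign, State.read,
        Addr.cell, T, W, cur, Arith.eval, beta, hermiteFactor, ← hd'] <;> ring_nf
  · simp [loadInterval, hr, block, exec, State.mem_assign, State.idx_assign, State.read,
      Addr.cell, T, W, cur]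

theorem mem_exec_loadInterval_of_ne {i : ℕ} (s : State Field) {f : Field} {k : ℕ}
    (hf : f ≠ .tmp) (hf' : ∀ b, f ≠ .ws i b) (hf'' : ∀ b, f ≠ .ws (i + 1) b) :
    (exec (loadInterval i) s).mem (f, k) = s.mem (f, k) := by
  refine WritesIn.mem_exec
    (φ := fun f => f = .tmp ∨ (∃ b, f = .ws i b) ∨ ∃ b, f = .ws (i + 1) b) ?_ s ?_
  · simp [loadInterval, writesIn_block, WritesIn, Addr.field, T, W, List.range_succ]
  · rintro (h | ⟨b, h⟩ | ⟨b, h⟩)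
    · exact hf h
    · exact hf' b h
    · exact hf'' b h

theorem mem_exec_loadRows (s : State Field) {a b : ℕ} (ha : a < 2) (hb : b < 5) :
    (exec loadRows s).mem (.ws a b, 0) = s.mem (.R a b, s.idx 1) := by
  have hr : List.range 5 = [0, 1, 2, 3, 4] := rfl
  interval_cases a <;> interval_cases b <;>
    simp [loadRows, hr, block, exec, State.mem_assign, State.idx_assign, State.read,
      Addr.cell, W, cur]

theorem mem_exec_storeRows (s : State Field) {a : ℕ} (ha : a < 2) :
    (∀ b < 5, (exec storeRows s).mem (.R a b, s.idx 1) = s.mem (.ws a b, 0)) ∧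
    (∀ b < 2, (exec storeRows s).mem (.R a b, s.idx 1 + 1) = s.mem (.ws (a + 2) (b + 2), 0)) ∧
    (exec storeRows s).mem (.R a 2, s.idx 1 + 1) = 0 ∧
    (exec storeRows s).mem (.R a 3, s.idx 1 + 1) = 0 ∧
    (exec storeRows s).mem (.R a 4, s.idx 1 + 1) = s.mem (.ws (a + 2) 4, 0) := by
  have hr : List.range 5 = [0, 1, 2, 3, 4] := rfl
  have hr' : List.range 2 = [0, 1] := rfl
  refine ⟨?_, ?_, ?_, ?_, ?_⟩
  · intro b hb
    interval_cases a <;> interval_cases b <;>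
      simp [storeRows, hr, hr', block, exec, State.mem_assign, State.idx_assign, State.read,
        Addr.cell, W, cur]
  · intro b hb
    interval_cases a <;> interval_cases b <;>
      simp [storeRows, hr, hr', block, exec, State.mem_assign, State.idx_assign, State.read,
        Addr.cell, W, cur]
  all_goals
    interval_cases a <;>
      simp [storeRows, hr, hr', block, exec, State.mem_assign, State.idx_assign, State.read,
        Addr.cell, W, cur]

theorem mem_exec_storeRows_of_ne (s : State Field) {a b k : ℕ} (h : k ≠ s.idx 1)
    (h' : k ≠ s.idx 1 + 1) : (exec storeRows s).mem (.R a b, k) = s.mem (.R a b, k) := by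
  have hr : List.range 5 = [0, 1, 2, 3, 4] := rfl
  have hr' : List.range 2 = [0, 1] := rfl
  simp [storeRows, hr, hr', block, exec, State.mem_assign, State.idx_assign, State.read,
    Addr.cell, W, cur, h, h']

/-! ### The initialization and the update as transformations of the memory -/

theorem exec_block_singleton {F : Type} [DecidableEq F] (P : Prog F) (s : State F) :
    exec (block [P]) s = exec P s := rfl

/-- The part of an update step that fills the workspace. -/
def loadUpdate : Prog Field := block [loadRows, loadInterval 2, loadSite 4 2 1]

/-- The part of an update step after the new rows have been stored. -/
def finishUpdate : Prog Field := block
  [.copy (cur .res 1) (W 4 4),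
   .arith .mul (T 0) (W 4 4) (W 4 4),
   .arith .add (cur .out 1) (cur .out 0) (T 0),
   .incIdx 1]

theorem exec_updateStep (s : State Field) : exec updateStep s =
    exec finishUpdate (exec storeRows
      (exec (block (planesFive.map fun q => rotate q.1 q.2)) (exec loadUpdate s))) := by
  have h : updateStep = block ([loadRows, loadInterval 2, loadSite 4 2 1] ++
      (planesFive.map (fun q => rotate q.1 q.2) ++ ([storeRows] ++
        [.copy (cur .res 1) (W 4 4),
         .arith .mul (T 0) (W 4 4) (W 4 4),
         .arith .add (cur .out 1) (cur .out 0) (T 0),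
         .incIdx 1]))) := rfl
  rw [h, exec_block_append, exec_block_append, exec_block_append, exec_block_singleton storeRows]
  rfl

/-- The part of the initialization that fills the workspace. -/
def loadInit : Prog Field := block [loadSite 0 0 0, loadInterval 1, loadSite 3 2 1]

/-- The part of the initialization after the rows have been stored. -/
def finishInit : Prog Field := block [.const (cur .out 1) 0, .incIdx 1]

theorem exec_initTwo (s : State Field) : exec initTwo s =
    exec finishInit (exec storeRows
      (exec (block (planesFour.map fun q => rotate q.1 q.2)) (exec loadInit s))) := by
  have h : initTwo = block ([loadSite 0 0 0, loadInterval 1, loadSite 3 2 1] ++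
      (planesFour.map (fun q => rotate q.1 q.2) ++ ([storeRows] ++
        [.const (cur .out 1) 0, .incIdx 1]))) := rfl
  rw [h, exec_block_append, exec_block_append, exec_block_append, exec_block_singleton storeRows]
  rfl

theorem keepsIdx_rotations (L : List (Fin 5 × Fin 5)) :
    KeepsIdx (block (L.map fun q => rotate q.1 q.2)) := by
  rw [keepsIdx_block]
  intro P hP
  obtain ⟨q, -, rfl⟩ := List.mem_map.mp hP
  simp [rotate, KeepsIdx, keepsIdx_block, List.range_succ]

theorem writesIn_rotations (L : List (Fin 5 × Fin 5)) :
    WritesIn IsScratch (block (L.map fun q => rotate q.1 q.2)) := by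
  rw [writesIn_block]
  intro P hP
  obtain ⟨q, -, rfl⟩ := List.mem_map.mp hP
  simp [rotate, WritesIn, writesIn_block, List.range_succ, Addr.field, T, W, IsScratch]

theorem keepsIdx_loadUpdate : KeepsIdx loadUpdate := by
  simp [loadUpdate, loadRows, loadInterval, loadSite, KeepsIdx, keepsIdx_block, List.range_succ]

theorem keepsIdx_loadInit : KeepsIdx loadInit := by
  simp [loadInit, loadInterval, loadSite, KeepsIdx, keepsIdx_block, List.range_succ]

theorem keepsIdx_storeRows : KeepsIdx storeRows := by
  simp [storeRows, KeepsIdx, keepsIdx_block, List.range_succ]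

theorem keepsIdx_loadRows : KeepsIdx loadRows := by
  simp [loadRows, KeepsIdx, keepsIdx_block, List.range_succ]

theorem keepsIdx_loadSite (i c o : ℕ) : KeepsIdx (loadSite i c o) := by
  simp [loadSite, KeepsIdx, keepsIdx_block, List.range_succ]

theorem keepsIdx_loadInterval (i : ℕ) : KeepsIdx (loadInterval i) := by
  simp [loadInterval, KeepsIdx, keepsIdx_block, List.range_succ]

theorem writesIn_loadRows : WritesIn IsScratch loadRows := by
  simp [loadRows, WritesIn, writesIn_block, List.range_succ, Addr.field, W, IsScratch]

theorem writesIn_loadSite (i c o : ℕ) : WritesIn IsScratch (loadSite i c o) := by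
  simp [loadSite, WritesIn, writesIn_block, List.range_succ, Addr.field, T, W, IsScratch]

theorem writesIn_loadInterval (i : ℕ) : WritesIn IsScratch (loadInterval i) := by
  simp [loadInterval, WritesIn, writesIn_block, List.range_succ, Addr.field, T, W, IsScratch]

theorem writesIn_loadUpdate : WritesIn IsScratch loadUpdate := by
  simp [loadUpdate, writesIn_block, writesIn_loadRows, writesIn_loadInterval, writesIn_loadSite]

theorem writesIn_loadInit : WritesIn IsScratch loadInit := by
  simp [loadInit, writesIn_block, writesIn_loadInterval, writesIn_loadSite]

theorem writesIn_storeRows : WritesIn (fun f => ∃ a b, f = .R a b) storeRows := by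
  simp [storeRows, WritesIn, writesIn_block, List.range_succ, Addr.field, cur]

theorem mem_exec_finishUpdate (s : State Field) :
    (exec finishUpdate s).idx 1 = s.idx 1 + 1 ∧
    (exec finishUpdate s).mem (.res, s.idx 1 + 1) = wsMat s 4 4 ∧
    (exec finishUpdate s).mem (.out, s.idx 1 + 1) =
      s.mem (.out, s.idx 1) + wsMat s 4 4 ^ 2 ∧
    ∀ c, c ≠ (.res, s.idx 1 + 1) → c ≠ (.out, s.idx 1 + 1) → c ≠ (.tmp, 0) →
      (exec finishUpdate s).mem c = s.mem c := by
  refine ⟨?_, ?_, ?_, ?_⟩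
  · simp [finishUpdate, block, exec, State.assignIdx, State.idx_assign]
  · simp [finishUpdate, block, exec, State.assignIdx, State.idx_assign, State.mem_assign,
      State.read, Addr.cell, cur, T, W, wsMat]
  · simp [finishUpdate, block, exec, State.assignIdx, State.idx_assign, State.mem_assign,
      State.read, Addr.cell, cur, T, W, wsMat, Arith.eval, sq]
  · intro c h1 h2 h3
    simp [finishUpdate, block, exec, State.assignIdx, State.idx_assign, State.mem_assign,
      Addr.cell, cur, T, W, h1, h2, h3]

theorem mem_exec_finishInit (s : State Field) :
    (exec finishInit s).idx 1 = s.idx 1 + 1 ∧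
    (exec finishInit s).mem (.out, s.idx 1 + 1) = 0 ∧
    ∀ c, c ≠ (.out, s.idx 1 + 1) → (exec finishInit s).mem c = s.mem c := by
  refine ⟨?_, ?_, ?_⟩
  · simp [finishInit, block, exec, State.assignIdx, State.idx_assign]
  · simp [finishInit, block, exec, State.assignIdx, State.mem_assign, Addr.cell, cur]
  · intro c h1
    simp [finishInit, block, exec, State.assignIdx, State.mem_assign, Addr.cell, cur, h1]

/-- The data cells hold the data of the `N` sites. -/
structure HoldsData (N : ℕ) (x y δ : ℕ → ℝ) (p : ℝ) (mem : Field × ℕ → ℝ) : Prop where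
  x : ∀ i < N, mem (.x, i) = x i
  y : ∀ i < N, mem (.y, i) = y i
  δ : ∀ i < N, mem (.δ, i) = δ i
  p : mem (.p, 0) = p

theorem wsMat_exec_loadUpdate {N : ℕ} {x y δ : ℕ → ℝ} {p : ℝ} {s : State Field} {r : ℕ}
    (hs : HoldsData N x y δ p s.mem) (hr : 1 ≤ r) (hrN : r < N) (hidx : s.idx 1 = r - 1)
    (hx : x (r - 1) < x r)
    (h0 : ∀ a < 2, s.mem (.R a 2, r - 1) = 0 ∧ s.mem (.R a 3, r - 1) = 0) :
    wsMat (exec loadUpdate s) = smallSystem x y δ p r s.mem := by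
  have hr1 : s.idx 1 + 1 = r := by omega
  set s1 := exec loadRows s with hs1
  set s2 := exec (loadInterval 2) s1 with hs2
  have hexec : exec loadUpdate s = exec (loadSite 4 2 1) s2 := rfl
  have i1 : s1.idx 1 = s.idx 1 := by rw [hs1, keepsIdx_loadRows.idx_exec]
  have i2 : s2.idx 1 = s.idx 1 := by rw [hs2, (keepsIdx_loadInterval 2).idx_exec, i1]
  have m1 : ∀ c, ¬ IsScratch c.1 → s1.mem c = s.mem c := fun c hc =>
    writesIn_loadRows.mem_exec _ hc
  have m2 : ∀ c, ¬ IsScratch c.1 → s2.mem c = s.mem c := fun c hc =>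
    ((writesIn_loadInterval 2).mem_exec _ hc).trans (m1 c hc)
  have hx0 : s1.mem (.x, s1.idx 1) = x (r - 1) := by
    rw [i1, m1 _ (by simp [IsScratch]), hidx, hs.x _ (by omega)]
  have hx1 : s1.mem (.x, s1.idx 1 + 1) = x r := by
    rw [i1, m1 _ (by simp [IsScratch]), hr1, hs.x _ hrN]
  have hp1 : s1.mem (.p, 0) = p := (m1 _ (by simp [IsScratch])).trans hs.p
  have hp2 : s2.mem (.p, 0) = p := (m2 _ (by simp [IsScratch])).trans hs.p
  have hy : s2.mem (.y, s2.idx 1 + 1) = y r := by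
    rw [i2, m2 _ (by simp [IsScratch]), hr1, hs.y _ hrN]
  have hδ : s2.mem (.δ, r) = δ r := by
    rw [m2 _ (by simp [IsScratch]), hs.δ _ hrN]
  obtain ⟨u0, u1, u2, u3⟩ := mem_exec_loadInterval_rows (i := 2) s1 (by rw [hx0, hx1]; exact hx)
  rw [← hs2, hx0, hx1, hp1] at u0 u2
  rw [← hs2] at u1 u3
  have top : ∀ a < 2, ∀ b < 5, (exec loadUpdate s).mem (.ws a b, 0) = s.mem (.R a b, r - 1) := by
    intro a ha b hb
    rw [hexec, mem_exec_loadSite_of_ne _ (by simp) (by simp; omega), hs2,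
      mem_exec_loadInterval_of_ne _ (by simp) (by simp; omega) (by simp; omega), hs1,
      mem_exec_loadRows _ ha hb, hidx]
  have mid : ∀ a b, a ≠ 4 → (exec loadUpdate s).mem (.ws a b, 0) = s2.mem (.ws a b, 0) := by
    intro a b ha
    rw [hexec, mem_exec_loadSite_of_ne _ (by simp) (by simp [ha])]
  have bot : ∀ b < 5, (exec loadUpdate s).mem (.ws 4 b, 0) =
      if b = 2 then alpha δ p r else if b = 4 then alpha δ p r * y r else 0 := by
    intro b hb
    rw [hexec, mem_exec_loadSite_row (by norm_num) _ hb, hp2, hy, i2, hr1]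
    simp only [alpha, hδ]
  generalize exec loadUpdate s = t at top mid bot ⊢
  have v0 := u0 0
  have v1 := u0 1
  have v2 := u0 2
  have v3 := u0 3
  have w0 := u2 0
  have w1 := u2 1
  have w2 := u2 2
  have w3 := u2 3
  simp at v0 v1 v2 v3 w0 w1 w2 w3 u1 u3
  have h00 := h0 0 (by norm_num)
  have h01 := h0 1 (by norm_num)
  ext a b
  fin_cases a <;> fin_cases b <;>
    simp [wsMat, smallSystem, top, mid, bot, h00, h01, v0, v1, v2, v3, w0, w1, w2, w3, u1, u3]

/-- The `4 × 4` system of the first two sites with its right-hand side, padded by a zero row. -/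
noncomputable def initialSystem (x y δ : ℕ → ℝ) (p : ℝ) : Matrix (Fin 5) (Fin 5) ℝ :=
  let B := beta p • hermiteFactor (x 1 - x 0)
  !![alpha δ p 0, 0, 0, 0, alpha δ p 0 * y 0;
    B 0 0, B 0 1, B 0 2, B 0 3, 0;
    B 1 0, B 1 1, B 1 2, B 1 3, 0;
    0, 0, alpha δ p 1, 0, alpha δ p 1 * y 1;
    0, 0, 0, 0, 0]

theorem wsMat_exec_loadInit {N : ℕ} {x y δ : ℕ → ℝ} {p : ℝ} {s : State Field}
    (hs : HoldsData N x y δ p s.mem) (hN : 1 < N) (hidx : s.idx 1 = 0) (hx : x 0 < x 1)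
    (h0 : ∀ b, s.mem (.ws 4 b, 0) = 0) :
    wsMat (exec loadInit s) = initialSystem x y δ p := by
  set s1 := exec (loadSite 0 0 0) s with hs1
  set s2 := exec (loadInterval 1) s1 with hs2
  have hexec : exec loadInit s = exec (loadSite 3 2 1) s2 := rfl
  have i1 : s1.idx 1 = 0 := by rw [hs1, (keepsIdx_loadSite 0 0 0).idx_exec, hidx]
  have i2 : s2.idx 1 = 0 := by rw [hs2, (keepsIdx_loadInterval 1).idx_exec, i1]
  have m1 : ∀ c, ¬ IsScratch c.1 → s1.mem c = s.mem c := fun c hc =>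
    (writesIn_loadSite 0 0 0).mem_exec _ hc
  have m2 : ∀ c, ¬ IsScratch c.1 → s2.mem c = s.mem c := fun c hc =>
    ((writesIn_loadInterval 1).mem_exec _ hc).trans (m1 c hc)
  have hx0 : s1.mem (.x, s1.idx 1) = x 0 := by
    rw [i1, m1 _ (by simp [IsScratch]), hs.x _ (by omega)]
  have hx1 : s1.mem (.x, s1.idx 1 + 1) = x 1 := by
    rw [i1, m1 _ (by simp [IsScratch]), hs.x _ (by omega)]
  have hp1 : s1.mem (.p, 0) = p := (m1 _ (by simp [IsScratch])).trans hs.p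
  have hp2 : s2.mem (.p, 0) = p := (m2 _ (by simp [IsScratch])).trans hs.p
  have hy : s2.mem (.y, s2.idx 1 + 1) = y 1 := by
    rw [i2, m2 _ (by simp [IsScratch]), hs.y _ (by omega)]
  have hδ : s2.mem (.δ, 1) = δ 1 := by
    rw [m2 _ (by simp [IsScratch]), hs.δ _ (by omega)]
  obtain ⟨u0, u1, u2, u3⟩ := mem_exec_loadInterval_rows (i := 1) s1 (by rw [hx0, hx1]; exact hx)
  rw [← hs2, hx0, hx1, hp1] at u0 u2
  rw [← hs2] at u1 u3
  have top : ∀ b < 5, (exec loadInit s).mem (.ws 0 b, 0) =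
      if b = 0 then alpha δ p 0 else if b = 4 then alpha δ p 0 * y 0 else 0 := by
    intro b hb
    rw [hexec, mem_exec_loadSite_of_ne _ (by simp) (by simp), hs2,
      mem_exec_loadInterval_of_ne _ (by simp) (by simp) (by simp), hs1,
      mem_exec_loadSite_row (by norm_num) _ hb, hs.p, hidx, hs.y _ (by omega)]
    simp only [alpha, zero_add, hs.δ 0 (by omega)]
  have mid : ∀ a b, a ≠ 3 → (exec loadInit s).mem (.ws a b, 0) = s2.mem (.ws a b, 0) := by
    intro a b ha
    rw [hexec, mem_exec_loadSite_of_ne _ (by simp) (by simp [ha])]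
  have bot : ∀ b < 5, (exec loadInit s).mem (.ws 3 b, 0) =
      if b = 2 then alpha δ p 1 else if b = 4 then alpha δ p 1 * y 1 else 0 := by
    intro b hb
    rw [hexec, mem_exec_loadSite_row (by norm_num) _ hb, hp2, hy, i2]
    simp only [alpha, zero_add, hδ]
  have last : ∀ b, s2.mem (.ws 4 b, 0) = 0 := by
    intro b
    rw [hs2, mem_exec_loadInterval_of_ne _ (by simp) (by simp) (by simp),
      hs1, mem_exec_loadSite_of_ne _ (by simp) (by simp), h0]
  generalize exec loadInit s = t at top mid bot ⊢
  have v0 := u0 0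
  have v1 := u0 1
  have v2 := u0 2
  have v3 := u0 3
  have w0 := u2 0
  have w1 := u2 1
  have w2 := u2 2
  have w3 := u2 3
  simp at v0 v1 v2 v3 w0 w1 w2 w3 u1 u3
  ext a b
  fin_cases a <;> fin_cases b <;>
    simp [wsMat, initialSystem, top, mid, bot, last, v0, v1, v2, v3, w0, w1, w2, w3, u1, u3]

/-- The state between two updates, when `r` sites have been processed. -/
structure Ready (N : ℕ) (x y δ : ℕ → ℝ) (p : ℝ) (r : ℕ) (s : State Field) : Prop where
  data : HoldsData N x y δ p s.mem
  idx : s.idx 1 = r - 1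
  last_two : ∀ a < 2, s.mem (.R a 2, r - 1) = 0
  last_three : ∀ a < 2, s.mem (.R a 3, r - 1) = 0

/-- The four stored rows at the places `k` and `k + 1`, padded by a row with right-hand side `e`. -/
def storedRows (k : ℕ) (e : ℝ) (mem : Field × ℕ → ℝ) : Matrix (Fin 5) (Fin 5) ℝ :=
  !![mem (.R 0 0, k), mem (.R 0 1, k), mem (.R 0 2, k), mem (.R 0 3, k), mem (.R 0 4, k);
    mem (.R 1 0, k), mem (.R 1 1, k), mem (.R 1 2, k), mem (.R 1 3, k), mem (.R 1 4, k);
    0, 0, mem (.R 0 0, k + 1), mem (.R 0 1, k + 1), mem (.R 0 4, k + 1);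
    0, 0, mem (.R 1 0, k + 1), mem (.R 1 1, k + 1), mem (.R 1 4, k + 1);
    0, 0, 0, 0, e]

/-- Storing a triangular workspace loses nothing. -/
theorem storedRows_exec_storeRows {s : State Field}
    (h : ∀ a b : Fin 5, b < a → b.val < 4 → wsMat s a b = 0) :
    storedRows (s.idx 1) (wsMat s 4 4) (exec storeRows s).mem = wsMat s := by
  obtain ⟨a0, a1, -, -, a4⟩ := mem_exec_storeRows s (show 0 < 2 by norm_num)
  obtain ⟨b0, b1, -, -, b4⟩ := mem_exec_storeRows s (show 1 < 2 by norm_num)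
  have h20 := h 2 0 (by decide) (by decide)
  have h21 := h 2 1 (by decide) (by decide)
  have h30 := h 3 0 (by decide) (by decide)
  have h31 := h 3 1 (by decide) (by decide)
  have h40 := h 4 0 (by decide) (by decide)
  have h41 := h 4 1 (by decide) (by decide)
  have h42 := h 4 2 (by decide) (by decide)
  have h43 := h 4 3 (by decide) (by decide)
  simp only [wsMat, Matrix.of_apply] at h20 h21 h30 h31 h40 h41 h42 h43
  simp at h20 h21 h30 h31 h40 h41 h42 h43
  generalize exec storeRows s = t at *
  ext a b
  fin_cases a <;> fin_cases b <;>
    simp [wsMat, storedRows, a0, a1, a4, b0, b1, b4, h20, h21, h30, h31, h40, h41, h42, h43]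

theorem reducedSystem_eq_storedRows {r : ℕ} (hr : 1 ≤ r) (mem : Field × ℕ → ℝ) :
    reducedSystem r mem = storedRows (r - 1) (mem (.res, r)) mem := by
  simp only [reducedSystem, storedRows, Nat.sub_add_cancel hr]

/-- The effect of one update step on everything but the temporaries. -/
structure UpdateSpec (x y δ : ℕ → ℝ) (p : ℝ) (r : ℕ) (mem mem' : Field × ℕ → ℝ) : Prop where
  rotations : ∃ L : List (Matrix (Fin 5) (Fin 5) ℝ), L.length ≤ 10 ∧
    (∀ G ∈ L, IsGivensRotation G) ∧ L.prod * smallSystem x y δ p r mem = reducedSystem r mem'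
  old_rows : ∀ k a b, k + 1 < r → mem' (.R a b, k) = mem (.R a b, k)
  old_res : ∀ k, k < r → mem' (.res, k) = mem (.res, k)
  old_out : ∀ k, k < r → mem' (.out, k) = mem (.out, k)
  out : mem' (.out, r) = mem (.out, r - 1) + mem' (.res, r) ^ 2
  lower_old : mem' (.R 1 0, r - 1) = 0
  lower_new : mem' (.R 1 0, r) = 0

theorem Ready.update {N : ℕ} {x y δ : ℕ → ℝ} {p : ℝ} {r : ℕ} {s : State Field}
    (hs : Ready N x y δ p r s) (hr : 1 ≤ r) (hrN : r < N) (hx : x (r - 1) < x r) :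
    Ready N x y δ p (r + 1) (exec updateStep s) ∧
      UpdateSpec x y δ p r s.mem (exec updateStep s).mem := by
  have hload := wsMat_exec_loadUpdate hs.data hr hrN hs.idx hx
    fun a ha => ⟨hs.last_two a ha, hs.last_three a ha⟩
  have hplanes : ∀ q ∈ planesFive, q.1 ≠ q.2 := by decide
  rw [exec_updateStep]
  set s1 := exec loadUpdate s with hs1
  set s2 := exec (block (planesFive.map fun q => rotate q.1 q.2)) s1 with hs2
  set s3 := exec storeRows s2 with hs3
  obtain ⟨f1, f2, f3, f4⟩ := mem_exec_finishUpdate s3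
  set s4 := exec finishUpdate s3 with hs4
  have i2 : s2.idx 1 = r - 1 := by
    rw [hs2, (keepsIdx_rotations _).idx_exec, hs1, keepsIdx_loadUpdate.idx_exec, hs.idx]
  have i3 : s3.idx 1 = r - 1 := by rw [hs3, keepsIdx_storeRows.idx_exec, i2]
  have hr1 : r - 1 + 1 = r := Nat.sub_add_cancel hr
  rw [i3, hr1] at f1 f2 f3 f4
  have m2 : ∀ c, ¬ IsScratch c.1 → s2.mem c = s.mem c := fun c hc =>
    ((writesIn_rotations _).mem_exec _ hc).trans (writesIn_loadUpdate.mem_exec _ hc)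
  have m3 : ∀ f k, (∀ a b, f ≠ .R a b) → s3.mem (f, k) = s2.mem (f, k) := fun f k hf =>
    writesIn_storeRows.mem_exec _ (by simpa using hf)
  have hR : ∀ a b k, s4.mem (.R a b, k) = s3.mem (.R a b, k) := fun a b k =>
    f4 _ (by simp) (by simp) (by simp)
  have hdata : ∀ f k, ¬ IsScratch f → (∀ a b, f ≠ .R a b) → f ≠ .res → f ≠ .out →
      s4.mem (f, k) = s.mem (f, k) := by
    intro f k h1 h2 h3 h4
    rw [f4 _ (by simp [h3]) (by simp [h4]) (by rintro ⟨⟩; exact h1 trivial), m3 _ _ h2, m2 _ h1]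
  have hws : wsMat s3 = wsMat s2 := by
    ext a b
    exact m3 (.ws a b) 0 (by simp)
  have hsweep : wsMat s2 = sweep planesFive (smallSystem x y δ p r s.mem) := by
    rw [hs2, wsMat_exec_rotations hplanes, hload]
  have hclear : ∀ a b : Fin 5, b < a → b.val < 4 → wsMat s2 a b = 0 := by
    intro a b hab hb
    rw [hsweep]
    exact cleared_sweep_planesFive _ a b a.isLt hab (Or.inl hb)
  have hstored := storedRows_exec_storeRows hclear
  rw [← hs3, i2] at hstored
  obtain ⟨G, hG, hG', hprod⟩ := exists_sweep_eq_prod_mul hplanes (smallSystem x y δ p r s.mem)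
  have hred : reducedSystem r s4.mem = wsMat s2 := by
    rw [← hstored, reducedSystem_eq_storedRows hr, f2, hws]
    simp only [storedRows, hR]
  refine ⟨⟨⟨?_, ?_, ?_, ?_⟩, ?_, ?_, ?_⟩, ⟨?_, ?_, ?_, ?_, ?_, ?_, ?_⟩⟩
  · intro i hi
    rw [hdata _ _ (by simp [IsScratch]) (by simp) (by simp) (by simp), hs.data.x i hi]
  · intro i hi
    rw [hdata _ _ (by simp [IsScratch]) (by simp) (by simp) (by simp), hs.data.y i hi]
  · intro i hi
    rw [hdata _ _ (by simp [IsScratch]) (by simp) (by simp) (by simp), hs.data.δ i hi]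
  · rw [hdata _ _ (by simp [IsScratch]) (by simp) (by simp) (by simp), hs.data.p]
  · rw [f1]; rfl
  · intro a ha
    have h := (mem_exec_storeRows s2 ha).2.2.1
    rw [i2, hr1] at h
    rw [Nat.add_sub_cancel, hR, hs3, h]
  · intro a ha
    have h := (mem_exec_storeRows s2 ha).2.2.2.1
    rw [i2, hr1] at h
    rw [Nat.add_sub_cancel, hR, hs3, h]
  · refine ⟨G, ?_, hG', ?_⟩
    · rw [hG]; decide
    · rw [hred, hsweep, hprod]
  · intro k a b hk
    rw [hR, hs3, mem_exec_storeRows_of_ne _ (by omega) (by omega), m2 _ (by simp [IsScratch])]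
  · intro k hk
    rw [f4 _ (by simp; omega) (by simp) (by simp), m3 _ _ (by simp), m2 _ (by simp [IsScratch])]
  · intro k hk
    rw [f4 _ (by simp) (by simp; omega) (by simp), m3 _ _ (by simp), m2 _ (by simp [IsScratch])]
  · rw [f3, f2, m3 _ _ (by simp), m2 _ (by simp [IsScratch])]
  · have h := congrFun (congrFun hred 1) 0
    rw [hclear 1 0 (by decide) (by decide)] at h
    exact h
  · have h := congrFun (congrFun hred 3) 2
    rw [hclear 3 2 (by decide) (by decide)] at h
    exact h

/-- The effect of the initialization with two sites. -/
structure InitSpec (x y δ : ℕ → ℝ) (p : ℝ) (mem mem' : Field × ℕ → ℝ) : Prop where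
  rotations : ∃ L : List (Matrix (Fin 5) (Fin 5) ℝ),
    (∀ G ∈ L, IsGivensRotation G) ∧ L.prod * initialSystem x y δ p = storedRows 0 0 mem'
  out_zero : mem' (.out, 0) = mem (.out, 0)
  out_one : mem' (.out, 1) = 0
  lower_zero : mem' (.R 1 0, 0) = 0
  lower_one : mem' (.R 1 0, 1) = 0

theorem exec_initTwo_spec {N : ℕ} {x y δ : ℕ → ℝ} {p : ℝ} {s : State Field}
    (hs : HoldsData N x y δ p s.mem) (hN : 1 < N) (hidx : s.idx 1 = 0) (hx : x 0 < x 1)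
    (h0 : ∀ b, s.mem (.ws 4 b, 0) = 0) :
    Ready N x y δ p 2 (exec initTwo s) ∧ InitSpec x y δ p s.mem (exec initTwo s).mem := by
  have hload := wsMat_exec_loadInit hs hN hidx hx h0
  have hplanes : ∀ q ∈ planesFour, q.1 ≠ q.2 := by decide
  rw [exec_initTwo]
  set s1 := exec loadInit s with hs1
  set s2 := exec (block (planesFour.map fun q => rotate q.1 q.2)) s1 with hs2
  set s3 := exec storeRows s2 with hs3
  obtain ⟨f1, f2, f3⟩ := mem_exec_finishInit s3
  set s4 := exec finishInit s3 with hs4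
  have i2 : s2.idx 1 = 0 := by
    rw [hs2, (keepsIdx_rotations _).idx_exec, hs1, keepsIdx_loadInit.idx_exec, hidx]
  have i3 : s3.idx 1 = 0 := by rw [hs3, keepsIdx_storeRows.idx_exec, i2]
  rw [i3, zero_add] at f1 f2 f3
  have m2 : ∀ c, ¬ IsScratch c.1 → s2.mem c = s.mem c := fun c hc =>
    ((writesIn_rotations _).mem_exec _ hc).trans (writesIn_loadInit.mem_exec _ hc)
  have m3 : ∀ f k, (∀ a b, f ≠ .R a b) → s3.mem (f, k) = s2.mem (f, k) := fun f k hf =>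
    writesIn_storeRows.mem_exec _ (by simpa using hf)
  have hR : ∀ a b k, s4.mem (.R a b, k) = s3.mem (.R a b, k) := fun a b k => f3 _ (by simp)
  have hdata : ∀ f k, ¬ IsScratch f → (∀ a b, f ≠ .R a b) → f ≠ .out →
      s4.mem (f, k) = s.mem (f, k) := by
    intro f k h1 h2 h3
    rw [f3 _ (by simp [h3]), m3 _ _ h2, m2 _ h1]
  have hsweep : wsMat s2 = sweep planesFour (initialSystem x y δ p) := by
    rw [hs2, wsMat_exec_rotations hplanes, hload]
  have hlast : ∀ b, wsMat s2 4 b = 0 := by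
    intro b
    rw [hsweep, sweep_row_eq hplanes (by decide)]
    fin_cases b <;> rfl
  have hclear : ∀ a b : Fin 5, b < a → b.val < 4 → wsMat s2 a b = 0 := by
    intro a b hab hb
    by_cases ha : a.val < 4
    · rw [hsweep]
      have h1 : b.val < a.val := hab
      exact cleared_sweep_planesFour _ a b ha hab (Or.inl (by omega))
    · have h4 : a = 4 := Fin.ext (by have := a.isLt; simp; omega)
      rw [h4, hlast]
  have hstored := storedRows_exec_storeRows hclear
  rw [← hs3, i2, hlast] at hstored
  obtain ⟨G, hG, hG', hprod⟩ := exists_sweep_eq_prod_mul hplanes (initialSystem x y δ p)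
  have hred : storedRows 0 0 s4.mem = wsMat s2 := by
    rw [← hstored]
    simp only [storedRows, hR]
  refine ⟨⟨⟨?_, ?_, ?_, ?_⟩, ?_, ?_, ?_⟩, ⟨?_, ?_, ?_, ?_, ?_⟩⟩
  · intro i hi
    rw [hdata _ _ (by simp [IsScratch]) (by simp) (by simp), hs.x i hi]
  · intro i hi
    rw [hdata _ _ (by simp [IsScratch]) (by simp) (by simp), hs.y i hi]
  · intro i hi
    rw [hdata _ _ (by simp [IsScratch]) (by simp) (by simp), hs.δ i hi]
  · rw [hdata _ _ (by simp [IsScratch]) (by simp) (by simp), hs.p]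
  · rw [f1]
  · intro a ha
    have h := (mem_exec_storeRows s2 ha).2.2.1
    rw [i2, zero_add] at h
    rw [hR, hs3, h]
  · intro a ha
    have h := (mem_exec_storeRows s2 ha).2.2.2.1
    rw [i2, zero_add] at h
    rw [hR, hs3, h]
  · exact ⟨G, hG', by rw [hred, hsweep, hprod]⟩
  · rw [f3 _ (by simp), m3 _ _ (by simp), m2 _ (by simp [IsScratch])]
  · exact f2
  · have h := congrFun (congrFun hred 1) 0
    rw [hclear 1 0 (by decide) (by decide)] at h
    exact h
  · have h := congrFun (congrFun hred 3) 2
    rw [hclear 3 2 (by decide) (by decide)] at h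
    exact h

/-! ### Orthogonal equivalence from equality of norms -/

/-- Linear maps into a Euclidean space with equal norms differ by an isometry of that space. -/
theorem exists_linearIsometry_of_norm_eq {V E : Type*} [AddCommGroup V] [Module ℝ V]
    [NormedAddCommGroup E] [InnerProductSpace ℝ E] [FiniteDimensional ℝ E] (f g : V →ₗ[ℝ] E)
    (h : ∀ v, ‖f v‖ = ‖g v‖) : ∃ Φ : E →ₗᵢ[ℝ] E, ∀ v, f v = Φ (g v) := by
  obtain ⟨σ, hσ⟩ := g.rangeRestrict.exists_rightInverse_of_surjective g.range_rangeRestrict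
  have hσ' : ∀ u : LinearMap.range g, g (σ u) = u := fun u =>
    congrArg Subtype.val (LinearMap.congr_fun hσ u)
  -- `f ∘ σ`, with `σ` a linear section of `g`, is isometric on the range of `g`
  let S : LinearMap.range g →ₗᵢ[ℝ] E :=
    { toLinearMap := f ∘ₗ σ
      norm_map' := fun u => by
        rw [LinearMap.comp_apply, h, hσ']
        rfl }
  refine ⟨S.extend, fun v => ?_⟩
  have h1 := S.extend_apply ⟨g v, LinearMap.mem_range_self g v⟩
  have h2 : f (v - σ ⟨g v, LinearMap.mem_range_self g v⟩) = 0 := by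
    rw [← norm_eq_zero, h, map_sub, hσ', sub_self, norm_zero]
  rw [map_sub, sub_eq_zero] at h2
  exact h2.trans h1.symm

theorem exists_orthogonal_of_sum_sq_eq {m n : Type*} [Fintype m] [DecidableEq m] [Fintype n]
    [DecidableEq n] (A R : Matrix m n ℝ) (y z : m → ℝ)
    (h : ∀ (v : n → ℝ) (t : ℝ),
      ∑ i, (A.mulVec v i + t * y i) ^ 2 = ∑ i, (R.mulVec v i + t * z i) ^ 2) :
    ∃ Q ∈ Matrix.orthogonalGroup m ℝ, A = Q * R ∧ z = Q.transpose.mulVec y := by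
  let lin : Matrix m n ℝ → (m → ℝ) → (n → ℝ) × ℝ →ₗ[ℝ] EuclideanSpace ℝ m := fun A y =>
    (WithLp.linearEquiv 2 ℝ (m → ℝ)).symm.toLinearMap ∘ₗ
      (A.mulVecLin ∘ₗ LinearMap.fst ℝ _ _ +
        (LinearMap.toSpanSingleton ℝ (m → ℝ) y) ∘ₗ LinearMap.snd ℝ _ _)
  have lin_apply : ∀ A y w i, lin A y w i = A.mulVec w.1 i + w.2 * y i := by
    intro A y w i
    simp [lin]
  obtain ⟨Φ, hΦ⟩ := exists_linearIsometry_of_norm_eq (lin A y) (lin R z) (by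
    intro w
    rw [EuclideanSpace.norm_eq, EuclideanSpace.norm_eq]
    simp only [lin_apply, Real.norm_eq_abs, sq_abs]
    rw [h])
  let Q : Matrix m m ℝ := Matrix.of fun i j => Φ (EuclideanSpace.single j 1) i
  have hQ : ∀ (u : EuclideanSpace ℝ m) (i : m), Φ u i = Q.mulVec u.ofLp i := by
    intro u i
    have hu : u = ∑ j, u j • EuclideanSpace.single j (1 : ℝ) := by
      ext k
      simp [Pi.single_apply]
    conv_lhs => rw [hu]
    simp [Matrix.mulVec, dotProduct, Q, mul_comm]
  have hQQ : Q.transpose * Q = 1 := by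
    ext i j
    have h1 := Φ.inner_map_map (EuclideanSpace.single j 1) (EuclideanSpace.single i 1)
    rw [PiLp.inner_apply] at h1
    simp only [RCLike.inner_apply, conj_trivial] at h1
    rw [Matrix.mul_apply]
    refine Eq.trans h1 ?_
    rw [EuclideanSpace.inner_single_left]
    simp [Matrix.one_apply, eq_comm]
  have horth : Q ∈ Matrix.orthogonalGroup m ℝ := (Matrix.mem_orthogonalGroup_iff' m ℝ).mpr hQQ
  refine ⟨Q, horth, ?_, ?_⟩
  · ext i j
    have h1 := congrArg (fun u => u i) (hΦ (Pi.single j 1, 0))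
    simp only [hQ, lin_apply] at h1
    have h2 : (lin R z (Pi.single j 1, 0)).ofLp = fun k => R k j := by
      ext k
      rw [lin_apply]
      simp
    rw [h2] at h1
    simpa [Matrix.mul_apply, Matrix.mulVec, dotProduct, Pi.single_apply] using h1
  · have h3 : y = Q.mulVec z := by
      ext i
      have h1 := congrArg (fun u => u i) (hΦ (0, 1))
      simp only [hQ, lin_apply] at h1
      have h2 : (lin R z (0, 1)).ofLp = z := by
        ext k
        rw [lin_apply]
        simp
      rw [h2] at h1
      simpa using h1
    rw [h3, Matrix.mulVec_mulVec, hQQ, Matrix.one_mulVec]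

/-! ### The least squares functional before and after triangularization -/

/-- Squared residual of the data row of site `i` at the unknowns `v`, with the right-hand side
scaled by `-t`. -/
noncomputable def dataTerm (y δ : ℕ → ℝ) (p : ℝ) (v : ℕ → ℝ) (t : ℝ) (i : ℕ) : ℝ :=
  (alpha δ p i * (v (2 * i) + t * y i)) ^ 2

/-- Squared residual of the two roughness rows of the interval after site `k`. -/
noncomputable def roughTerm (x : ℕ → ℝ) (p : ℝ) (v : ℕ → ℝ) (k : ℕ) : ℝ :=
  ∑ a : Fin 2, (∑ b : Fin 4, beta p * hermiteFactor (x (k + 1) - x k) a b * v (2 * k + b)) ^ 2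

/-- The squared norm of `A⁽ʳ⁾ v + t ỹ⁽ʳ⁾`. -/
noncomputable def systemNorm (x y δ : ℕ → ℝ) (p : ℝ) (r : ℕ) (v : ℕ → ℝ) (t : ℝ) : ℝ :=
  ∑ i ∈ Finset.range r, dataTerm y δ p v t i + ∑ k ∈ Finset.range (r - 1), roughTerm x p v k

/-- The stored row `a` at the place `k`, applied to the unknowns `v`. -/
noncomputable def storedRow (mem : Field × ℕ → ℝ) (v : ℕ → ℝ) (k a : ℕ) : ℝ :=
  ∑ b : Fin 4, mem (.R a b, k) * v (2 * k + b)

/-- Squared norm of the two stored rows at the place `k`. -/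
noncomputable def storedTerm (mem : Field × ℕ → ℝ) (v : ℕ → ℝ) (t : ℝ) (k : ℕ) : ℝ :=
  ∑ a : Fin 2, (storedRow mem v k a + t * mem (.R a 4, k)) ^ 2

/-- The squared norm of `R v + t z`. -/
noncomputable def storedNorm (mem : Field × ℕ → ℝ) (r : ℕ) (v : ℕ → ℝ) (t : ℝ) : ℝ :=
  ∑ k ∈ Finset.range r, storedTerm mem v t k +
    ∑ i ∈ Finset.range (r - 2), (t * mem (.res, i + 2)) ^ 2

theorem sum_sq_storedRows (k : ℕ) (e : ℝ) (mem : Field × ℕ → ℝ) (v : ℕ → ℝ) (t : ℝ)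
    (h2 : ∀ a < 2, mem (.R a 2, k + 1) = 0) (h3 : ∀ a < 2, mem (.R a 3, k + 1) = 0) :
    ∑ a, ((storedRows k e mem).mulVec
      ![v (2 * k), v (2 * k + 1), v (2 * k + 2), v (2 * k + 3), t] a) ^ 2 =
      storedTerm mem v t k + storedTerm mem v t (k + 1) + (t * e) ^ 2 := by
  simp [storedRows, storedTerm, storedRow, Matrix.mulVec, dotProduct, Fin.sum_univ_succ, h2, h3,
    mul_add]
  ring

theorem storedNorm_eq_of_init {x y δ : ℕ → ℝ} {p : ℝ} {mem mem' : Field × ℕ → ℝ}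
    (h : InitSpec x y δ p mem mem') (h2 : ∀ a < 2, mem' (.R a 2, 1) = 0)
    (h3 : ∀ a < 2, mem' (.R a 3, 1) = 0) (v : ℕ → ℝ) (t : ℝ) :
    systemNorm x y δ p 2 v t = storedNorm mem' 2 v t := by
  obtain ⟨L, hL, hprod⟩ := h.rotations
  have h1 := sum_sq_storedRows 0 0 mem' v t h2 h3
  rw [← hprod, ← Matrix.mulVec_mulVec, sum_sq_mulVec_of_givens_prod hL] at h1
  simp only [systemNorm, storedNorm, Finset.sum_range_succ, Finset.sum_range_zero]
  simp only [mul_zero, zero_add] at h1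
  simp only [Nat.sub_self, Finset.sum_range_zero, zero_add]
  have h4 : storedTerm mem' v t 0 + storedTerm mem' v t 1 =
      dataTerm y δ p v t 0 + dataTerm y δ p v t 1 + roughTerm x p v 0 := by
    rw [zero_pow two_ne_zero, add_zero] at h1
    rw [← h1]
    simp [initialSystem, dataTerm, roughTerm, Matrix.mulVec, dotProduct, Fin.sum_univ_succ]
    ring
  linarith

theorem storedNorm_eq_of_update {x y δ : ℕ → ℝ} {p : ℝ} {r : ℕ} {mem mem' : Field × ℕ → ℝ}
    (hr : 2 ≤ r) (h : UpdateSpec x y δ p r mem mem')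
    (o2 : ∀ a < 2, mem (.R a 2, r - 1) = 0) (o3 : ∀ a < 2, mem (.R a 3, r - 1) = 0)
    (h2 : ∀ a < 2, mem' (.R a 2, r) = 0) (h3 : ∀ a < 2, mem' (.R a 3, r) = 0)
    (ih : ∀ v t, systemNorm x y δ p r v t = storedNorm mem r v t) (v : ℕ → ℝ) (t : ℝ) :
    systemNorm x y δ p (r + 1) v t = storedNorm mem' (r + 1) v t := by
  obtain ⟨L, -, hL, hprod⟩ := h.rotations
  obtain ⟨k, rfl⟩ : ∃ k, r = k + 2 := ⟨r - 2, by omega⟩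
  simp only [show k + 2 - 1 = k + 1 by omega] at *
  have h1 := sum_sq_storedRows (k + 1) (mem' (.res, k + 2)) mem' v t h2 h3
  have h5 := reducedSystem_eq_storedRows (r := k + 2) (by omega) mem'
  rw [show k + 2 - 1 = k + 1 by omega] at h5
  rw [← h5, ← hprod, ← Matrix.mulVec_mulVec, sum_sq_mulVec_of_givens_prod hL] at h1
  have h6 : storedTerm mem v t (k + 1) + roughTerm x p v (k + 1) + dataTerm y δ p v t (k + 2) =
      storedTerm mem' v t (k + 1) + storedTerm mem' v t (k + 1 + 1) +
        (t * mem' (.res, k + 2)) ^ 2 := by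
    rw [← h1]
    simp [smallSystem, dataTerm, roughTerm, storedTerm, storedRow, Matrix.mulVec, dotProduct,
      Fin.sum_univ_succ, o2, o3, mul_add]
    ring
  have h7 : ∑ i ∈ Finset.range (k + 1), storedTerm mem' v t i =
      ∑ i ∈ Finset.range (k + 1), storedTerm mem v t i := by
    refine Finset.sum_congr rfl fun i hi => ?_
    rw [Finset.mem_range] at hi
    simp only [storedTerm, storedRow, h.old_rows i _ _ (show i + 1 < k + 2 by omega)]
  have h8 : ∑ i ∈ Finset.range k, (t * mem' (.res, i + 2)) ^ 2 =
      ∑ i ∈ Finset.range k, (t * mem (.res, i + 2)) ^ 2 := by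
    refine Finset.sum_congr rfl fun i hi => ?_
    rw [Finset.mem_range] at hi
    rw [h.old_res (i + 2) (by omega)]
  have h9 := ih v t
  simp only [systemNorm, storedNorm, show k + 2 + 1 - 1 = k + 2 by omega,
    show k + 2 + 1 - 2 = k + 1 by omega, show k + 2 - 1 = k + 1 by omega,
    show k + 2 - 2 = k by omega, Finset.sum_range_succ _ (k + 2), Finset.sum_range_succ _ (k + 1),
    Finset.sum_range_succ _ k, h8] at h9 ⊢
  simp only [Finset.sum_range_succ _ k] at h7
  linarith

/-! ### Matrices with rows and columns numbered by natural numbers -/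

/-- A vector as a sequence that vanishes beyond its length. -/
noncomputable def extend {n : ℕ} (v : Fin n → ℝ) (j : ℕ) : ℝ := if h : j < n then v ⟨j, h⟩ else 0

theorem sum_ite_val_eq_mul {n : ℕ} (v : Fin n → ℝ) (a : ℕ) (c : ℝ) :
    ∑ j, (if j.val = a then c else 0) * v j = c * extend v a := by
  unfold extend
  split_ifs with h
  · rw [Finset.sum_eq_single ⟨a, h⟩]
    · simp
    · intro j _ hj
      rw [if_neg fun h' => hj (Fin.ext h'), zero_mul]
    · simp
  · rw [mul_zero]
    refine Finset.sum_eq_zero fun j _ => ?_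
    rw [if_neg, zero_mul]
    rintro rfl
    exact h j.isLt

theorem sum_band_mul {n : ℕ} (v : Fin n → ℝ) (a : ℕ) (c : Fin 4 → ℝ) (d : Fin n → ℝ)
    (hd : ∀ j : Fin n, ∀ b : Fin 4, j.val = a + b → d j = c b)
    (hd' : ∀ j : Fin n, ¬ (a ≤ j.val ∧ j.val < a + 4) → d j = 0) :
    ∑ j, d j * v j = ∑ b : Fin 4, c b * extend v (a + b) := by
  simp only [← sum_ite_val_eq_mul]
  rw [Finset.sum_comm]
  refine Finset.sum_congr rfl fun j _ => ?_
  rw [← Finset.sum_mul]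
  congr 1
  by_cases h : a ≤ j.val ∧ j.val < a + 4
  · rw [Finset.sum_eq_single ⟨j.val - a, by omega⟩]
    · rw [if_pos (by simp; omega)]
      exact hd j _ (by simp; omega)
    · intro b _ hb
      rw [if_neg]
      intro h'
      exact hb (Fin.ext (by simp; omega))
    · simp
  · rw [hd' j h]
    symm
    refine Finset.sum_eq_zero fun b _ => if_neg ?_
    have := b.isLt
    omega

theorem sum_range_three_mul_add_one (g : ℕ → ℝ) (n : ℕ) :
    ∑ i ∈ Finset.range (3 * n + 1), g i = ∑ m ∈ Finset.range (n + 1), g (3 * m) +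
      ∑ k ∈ Finset.range n, (g (3 * k + 1) + g (3 * k + 2)) := by
  induction n with
  | zero => simp
  | succ n ih =>
    rw [show 3 * (n + 1) + 1 = 3 * n + 1 + 1 + 1 + 1 by ring, Finset.sum_range_succ,
      Finset.sum_range_succ, Finset.sum_range_succ, ih,
      Finset.sum_range_succ (fun m => g (3 * m)) (n + 1),
      Finset.sum_range_succ (fun k => g (3 * k + 1) + g (3 * k + 2)) n,
      show 3 * (n + 1) = 3 * n + 1 + 1 + 1 by ring]
    ring

theorem sum_range_two_mul (g : ℕ → ℝ) (n : ℕ) :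
    ∑ i ∈ Finset.range (2 * n), g i = ∑ k ∈ Finset.range n, (g (2 * k) + g (2 * k + 1)) := by
  induction n with
  | zero => simp
  | succ n ih =>
    rw [show 2 * (n + 1) = 2 * n + 1 + 1 by ring, Finset.sum_range_succ,
      Finset.sum_range_succ, ih, Finset.sum_range_succ _ n]
    ring

theorem sum_sq_systemMatrix (x y δ : ℕ → ℝ) (p : ℝ) {r : ℕ} (hr : 1 ≤ r) (v : Fin (2 * r) → ℝ)
    (t : ℝ) :
    ∑ i, ((systemMatrix x δ p r).mulVec v i + t * systemRhs y δ p r i) ^ 2 =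
      systemNorm x y δ p r (extend v) t := by
  let g : ℕ → ℝ := fun i => if h : i % 3 = 0 then dataTerm y δ p (extend v) t (i / 3) else
    (∑ b : Fin 4, beta p * hermiteFactor (x (i / 3 + 1) - x (i / 3)) ⟨i % 3 - 1, by omega⟩ b *
      extend v (2 * (i / 3) + b)) ^ 2
  have hg : ∀ i : Fin (3 * r - 2),
      ((systemMatrix x δ p r).mulVec v i + t * systemRhs y δ p r i) ^ 2 = g i := by
    intro i
    by_cases h : i.val % 3 = 0
    · simp only [g, h, dif_pos, dataTerm, Matrix.mulVec, dotProduct, systemMatrix, systemRhs,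
        Matrix.of_apply, if_true, sum_ite_val_eq_mul]
      ring
    · simp only [g, h, dif_neg, not_false_eq_true, Matrix.mulVec, dotProduct, systemRhs, if_false,
        mul_zero, add_zero]
      congr 1
      refine sum_band_mul v (2 * (i.val / 3)) _ _ ?_ ?_
      · intro j b hj
        have hb := b.isLt
        simp only [systemMatrix, Matrix.of_apply, h, if_false]
        rw [dif_pos (by omega)]
        congr 2
        exact Fin.ext (by simp; omega)
      · intro j hj
        simp only [systemMatrix, Matrix.of_apply, h, if_false]
        rw [dif_neg hj]
  simp only [hg]
  rw [Fin.sum_univ_eq_sum_range]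
  obtain ⟨n, rfl⟩ : ∃ n, r = n + 1 := ⟨r - 1, by omega⟩
  rw [show 3 * (n + 1) - 2 = 3 * n + 1 by omega, sum_range_three_mul_add_one, systemNorm,
    Nat.add_sub_cancel]
  congr 1
  · refine Finset.sum_congr rfl fun m _ => ?_
    simp [g]
  · refine Finset.sum_congr rfl fun k _ => ?_
    have e1 : (3 * k + 1) % 3 = 1 := by omega
    have e2 : (3 * k + 2) % 3 = 2 := by omega
    have e3 : (3 * k + 1) / 3 = k := by omega
    have e4 : (3 * k + 2) / 3 = k := by omega
    simp only [g, e1, e2, e3, e4, roughTerm]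
    simp [Fin.sum_univ_two]

theorem sum_stored_rows {r : ℕ} (hr : 2 ≤ r) (f : ℕ → ℕ → ℝ) (g : ℕ → ℝ) :
    ∑ i : Fin (3 * r - 2), (if i.val < 2 * r then f (i.val / 2) (i.val % 2)
      else g (i.val - 2 * r + 2)) =
      ∑ k ∈ Finset.range r, (f k 0 + f k 1) + ∑ i ∈ Finset.range (r - 2), g (i + 2) := by
  rw [Fin.sum_univ_eq_sum_range
    (fun i => if i < 2 * r then f (i / 2) (i % 2) else g (i - 2 * r + 2)),
    show 3 * r - 2 = 2 * r + (r - 2) by omega, Finset.sum_range_add, sum_range_two_mul]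
  congr 1
  · refine Finset.sum_congr rfl fun k hk => ?_
    rw [Finset.mem_range] at hk
    rw [if_pos (by omega), if_pos (by omega), show 2 * k / 2 = k by omega,
      show 2 * k % 2 = 0 by omega, show (2 * k + 1) / 2 = k by omega,
      show (2 * k + 1) % 2 = 1 by omega]
  · refine Finset.sum_congr rfl fun i _ => ?_
    rw [if_neg (by omega), show 2 * r + i - 2 * r + 2 = i + 2 by omega]

theorem storedR_mulVec (mem : Field × ℕ → ℝ) {r : ℕ} (v : Fin (2 * r) → ℝ)
    (i : Fin (3 * r - 2)) : (storedR mem r).mulVec v i =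
      if i.val < 2 * r then storedRow mem (extend v) (i.val / 2) (i.val % 2) else 0 := by
  simp only [Matrix.mulVec, dotProduct]
  split_ifs with h
  · refine sum_band_mul v (2 * (i.val / 2)) _ _ ?_ ?_
    · intro j b hj
      have hb := b.isLt
      simp only [storedR, Matrix.of_apply]
      rw [if_pos ⟨h, by omega, by omega⟩, hj, Nat.add_sub_cancel_left]
    · intro j hj
      simp only [storedR, Matrix.of_apply]
      rw [if_neg fun h' => hj h'.2]
  · refine Finset.sum_eq_zero fun j _ => ?_
    simp only [storedR, Matrix.of_apply]
    rw [if_neg fun h' => h h'.1, zero_mul]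

theorem sum_sq_stored (mem : Field × ℕ → ℝ) {r : ℕ} (hr : 2 ≤ r) (v : Fin (2 * r) → ℝ) (t : ℝ) :
    ∑ i, ((storedR mem r).mulVec v i + t * storedZ mem r i) ^ 2 =
      storedNorm mem r (extend v) t := by
  have h := sum_stored_rows hr
    (fun k a => (storedRow mem (extend v) k a + t * mem (.R a 4, k)) ^ 2)
    (fun i => (t * mem (.res, i)) ^ 2)
  simp only [storedNorm, storedTerm, Fin.sum_univ_two, Fin.val_zero, Fin.val_one]
  rw [← h]
  refine Finset.sum_congr rfl fun i _ => ?_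
  rw [storedR_mulVec, storedZ]
  split_ifs <;> simp

theorem sum_sq_storedZ_filter (mem : Field × ℕ → ℝ) {r : ℕ} (hr : 2 ≤ r) :
    ∑ i ∈ Finset.univ.filter (fun i : Fin (3 * r - 2) => 2 * r ≤ i.val), storedZ mem r i ^ 2 =
      ∑ i ∈ Finset.range (r - 2), mem (.res, i + 2) ^ 2 := by
  have h := sum_stored_rows hr (fun _ _ => 0) (fun i => mem (.res, i) ^ 2)
  simp only [add_zero, Finset.sum_const_zero, zero_add] at h
  rw [← h, Finset.sum_filter]
  refine Finset.sum_congr rfl fun i _ => ?_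
  rw [storedZ]
  split_ifs <;> first | rfl | omega

theorem isQRSystem_of_norm_eq {x y δ : ℕ → ℝ} {p : ℝ} {r : ℕ} (hr : 2 ≤ r)
    {mem : Field × ℕ → ℝ} (h : ∀ v t, systemNorm x y δ p r v t = storedNorm mem r v t)
    (hlow : ∀ k < r, mem (.R 1 0, k) = 0) :
    IsQRSystem x y δ p r (storedR mem r) (storedZ mem r) := by
  refine ⟨?_, exists_orthogonal_of_sum_sq_eq _ _ _ _ fun v t => ?_⟩
  · intro i j hij
    simp only [storedR, Matrix.of_apply]
    split_ifs with h1
    · rw [show i.val % 2 = 1 by omega, show j.val - 2 * (i.val / 2) = 0 by omega]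
      exact hlow _ (by omega)
    · rfl
  · rw [sum_sq_systemMatrix x y δ p (by omega), sum_sq_stored mem hr, h]

/-! ### Cubic Hermite interpolation -/

/-- The least value of `∫ (f'')²` over an interval of length `d`, given the values `f₀`, `f₁` and
the slopes `s₀`, `s₁` at its end points. -/
noncomputable def hermiteEnergy (d f₀ s₀ f₁ s₁ : ℝ) : ℝ :=
  12 / d ^ 3 * (f₀ - f₁ + d * (s₀ + s₁) / 2) ^ 2 + (s₀ - s₁) ^ 2 / d

/-- The second derivative at the left end point of the cubic with the given Hermite data. -/
noncomputable def leftMoment (d f₀ s₀ f₁ s₁ : ℝ) : ℝ :=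
  (s₁ - s₀) / d - 6 / d ^ 2 * (f₀ - f₁ + d * (s₀ + s₁) / 2)

/-- The second derivative at the right end point of the cubic with the given Hermite data. -/
noncomputable def rightMoment (d f₀ s₀ f₁ s₁ : ℝ) : ℝ :=
  (s₁ - s₀) / d + 6 / d ^ 2 * (f₀ - f₁ + d * (s₀ + s₁) / 2)

theorem slope_eq_of_moments {d : ℝ} (hd : d ≠ 0) (f₀ s₀ f₁ s₁ : ℝ) :
    s₁ = s₀ + d * (leftMoment d f₀ s₀ f₁ s₁ + rightMoment d f₀ s₀ f₁ s₁) / 2 := by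
  unfold leftMoment rightMoment
  field_simp
  ring

theorem value_eq_of_moments {d : ℝ} (hd : d ≠ 0) (f₀ s₀ f₁ s₁ : ℝ) :
    f₁ = f₀ + d * s₀ +
      d ^ 2 * (2 * leftMoment d f₀ s₀ f₁ s₁ + rightMoment d f₀ s₀ f₁ s₁) / 6 := by
  unfold leftMoment rightMoment
  field_simp
  ring

theorem hermiteEnergy_eq_of_moments {d : ℝ} (hd : d ≠ 0) (f₀ s₀ f₁ s₁ : ℝ) :
    hermiteEnergy d f₀ s₀ f₁ s₁ = d * (leftMoment d f₀ s₀ f₁ s₁ ^ 2 +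
      leftMoment d f₀ s₀ f₁ s₁ * rightMoment d f₀ s₀ f₁ s₁ +
      rightMoment d f₀ s₀ f₁ s₁ ^ 2) / 3 := by
  unfold hermiteEnergy leftMoment rightMoment
  field_simp
  ring

/-- The derivative of the energy with respect to the slopes consists of the moments. -/
theorem hermiteEnergy_slopes_add {d : ℝ} (hd : d ≠ 0) (f₀ s₀ f₁ s₁ a b ε : ℝ) :
    hermiteEnergy d f₀ (s₀ + ε * a) f₁ (s₁ + ε * b) = hermiteEnergy d f₀ s₀ f₁ s₁ +
      2 * ε * (rightMoment d f₀ s₀ f₁ s₁ * b - leftMoment d f₀ s₀ f₁ s₁ * a) +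
      ε ^ 2 * hermiteEnergy d 0 a 0 b := by
  unfold hermiteEnergy leftMoment rightMoment
  field_simp
  ring

theorem integral_affine_sq (a b m q : ℝ) :
    ∫ t in a..b, (m + q * (t - a)) ^ 2 =
      m ^ 2 * (b - a) + m * q * (b - a) ^ 2 + q ^ 2 * (b - a) ^ 3 / 3 := by
  have h : ∀ t ∈ Set.uIcc a b, HasDerivAt
      (fun t => m ^ 2 * (t - a) + m * q * (t - a) ^ 2 + q ^ 2 * (t - a) ^ 3 / 3)
      ((m + q * (t - a)) ^ 2) t := by
    intro t _
    have h1 : HasDerivAt (fun t => t - a) 1 t := (hasDerivAt_id t).sub_const a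
    refine (((h1.const_mul (m ^ 2)).add ((h1.pow 2).const_mul (m * q))).add
      (((h1.pow 3).const_mul (q ^ 2)).div_const 3)).congr_deriv ?_
    norm_num
    ring
  rw [intervalIntegral.integral_eq_sub_of_hasDerivAt h
    (Continuous.intervalIntegrable (by fun_prop) _ _)]
  ring

/-- The Hermite energy bounds the roughness of every function with the given Hermite data: by
partial integration, it is the squared norm of the projection of `f''` to the affine functions. -/
theorem hermiteEnergy_le_integral {a b : ℝ} (hab : a < b) {f f₁ f₂ : ℝ → ℝ}
    (hf : ContinuousOn f (Set.Icc a b)) (hf₁ : ContinuousOn f₁ (Set.Icc a b))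
    (hf₂ : ContinuousOn f₂ (Set.Icc a b)) (hd : ∀ t ∈ Set.Ioo a b, HasDerivAt f (f₁ t) t)
    (hd₁ : ∀ t ∈ Set.Ioo a b, HasDerivAt f₁ (f₂ t) t) :
    hermiteEnergy (b - a) (f a) (f₁ a) (f b) (f₁ b) ≤ ∫ t in a..b, f₂ t ^ 2 := by
  have hba : b - a ≠ 0 := (sub_pos.mpr hab).ne'
  -- `m + q (t - a)` is the projection of `f''` to the affine functions
  set m := leftMoment (b - a) (f a) (f₁ a) (f b) (f₁ b) with hm
  set q := 12 / (b - a) ^ 3 * (f a - f b + (b - a) * (f₁ a + f₁ b) / 2) with hq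
  set G : ℝ → ℝ := fun t => 2 * ((m + q * (t - a)) * f₁ t - q * f t) -
    (m ^ 2 * (t - a) + m * q * (t - a) ^ 2 + q ^ 2 * (t - a) ^ 3 / 3) with hG
  have hGd : ∀ t ∈ Set.Ioo a b,
      HasDerivAt G (2 * (f₂ t * (m + q * (t - a))) - (m + q * (t - a)) ^ 2) t := by
    intro t ht
    have h1 : HasDerivAt (fun t => t - a) 1 t := (hasDerivAt_id t).sub_const a
    have h2 : HasDerivAt (fun t => m ^ 2 * (t - a) + m * q * (t - a) ^ 2 +
        q ^ 2 * (t - a) ^ 3 / 3) ((m + q * (t - a)) ^ 2) t := by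
      refine (((h1.const_mul (m ^ 2)).add ((h1.pow 2).const_mul (m * q))).add
        (((h1.pow 3).const_mul (q ^ 2)).div_const 3)).congr_deriv ?_
      norm_num
      ring
    have h3 : HasDerivAt (fun t => m + q * (t - a)) q t :=
      ((h1.const_mul q).const_add m).congr_deriv (mul_one q)
    refine ((((h3.mul (hd₁ t ht)).sub ((hd t ht).const_mul q)).const_mul 2).sub h2).congr_deriv ?_
    ring
  have hGc : ContinuousOn G (Set.Icc a b) := by
    rw [hG]
    fun_prop
  have hint : IntervalIntegrable (fun t => 2 * (f₂ t * (m + q * (t - a))) - (m + q * (t - a)) ^ 2)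
      MeasureTheory.volume a b := by
    refine ContinuousOn.intervalIntegrable ?_
    rw [Set.uIcc_of_le hab.le]
    fun_prop
  have hint' : IntervalIntegrable (fun t => f₂ t ^ 2) MeasureTheory.volume a b := by
    refine ContinuousOn.intervalIntegrable ?_
    rw [Set.uIcc_of_le hab.le]
    fun_prop
  have h1 := intervalIntegral.integral_eq_sub_of_hasDerivAt_of_le hab.le hGc hGd hint
  have h2 := intervalIntegral.integral_mono_on hab.le hint hint' fun t _ => by
    nlinarith [sq_nonneg (f₂ t - (m + q * (t - a)))]
  rw [h1] at h2
  refine le_trans (le_of_eq ?_) h2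
  simp only [hG, hm, hq, hermiteEnergy, leftMoment]
  field_simp
  ring

/-! ### Natural cubic splines -/

theorem hasDerivAt_max_zero_pow (n : ℕ) (u : ℝ) :
    HasDerivAt (fun u : ℝ => max u 0 ^ (n + 2)) ((n + 2) * max u 0 ^ (n + 1)) u := by
  have hpow : HasDerivAt (fun u : ℝ => u ^ (n + 2)) ((n + 2) * u ^ (n + 1)) u := by
    have := hasDerivAt_pow (n + 2) u
    push_cast at this
    exact this
  rcases lt_trichotomy u 0 with hu | rfl | hu
  · rw [max_eq_right hu.le, zero_pow (by omega), mul_zero]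
    refine (hasDerivAt_const u (0 : ℝ)).congr_of_eventuallyEq ?_
    filter_upwards [Iio_mem_nhds hu] with v hv
    rw [max_eq_right (le_of_lt hv), zero_pow (by omega)]
  · rw [← hasDerivWithinAt_univ, ← Set.Iic_union_Ici (a := (0 : ℝ))]
    refine HasDerivWithinAt.union ?_ ?_
    · rw [max_self, zero_pow (by omega), mul_zero]
      refine (hasDerivWithinAt_const 0 _ (0 : ℝ)).congr (fun v hv => ?_) ?_
      · rw [max_eq_right hv, zero_pow (by omega)]
      · rw [max_self, zero_pow (by omega)]
    · rw [max_self]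
      refine hpow.hasDerivWithinAt.congr (fun v hv => ?_) ?_
      · rw [max_eq_left hv]
      · rw [max_self]
  · rw [max_eq_left hu.le]
    refine hpow.congr_of_eventuallyEq ?_
    filter_upwards [Ioi_mem_nhds hu] with v hv
    rw [max_eq_left (le_of_lt hv)]

theorem sum_mul_max_pow_eq {n : ℕ} {x : ℕ → ℝ} (hx : ∀ i j, i < j → j ≤ n → x i < x j)
    (c : ℕ → ℝ) {e : ℕ} (he : e ≠ 0) {k : ℕ} (hk : k ≤ n) {t : ℝ} (ht : x k ≤ t)
    (ht' : k < n → t ≤ x (k + 1)) :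
    ∑ j ∈ Finset.range (n + 1), c j * max (t - x j) 0 ^ e =
      ∑ j ∈ Finset.range (k + 1), c j * (t - x j) ^ e := by
  rw [← Finset.sum_subset (Finset.range_mono (show k + 1 ≤ n + 1 by omega))]
  · refine Finset.sum_congr rfl fun j hj => ?_
    rw [Finset.mem_range] at hj
    have : x j ≤ x k := by
      rcases Nat.lt_or_ge j k with h | h
      · exact (hx j k h hk).le
      · rw [show j = k by omega]
    rw [max_eq_left (by linarith)]
  · intro j hj hj'
    rw [Finset.mem_range] at hj hj'
    have : x (k + 1) ≤ x j := by
      rcases Nat.lt_or_ge (k + 1) j with h | h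
      · exact (hx (k + 1) j h (by omega)).le
      · rw [show k + 1 = j by omega]
    have h1 := ht' (by omega)
    rw [max_eq_right (by linarith), zero_pow he, mul_zero]

/-- The natural cubic spline with the given values and moments at the knots, which are linked by
slopes such that the cubic pieces fit. -/
theorem exists_natural_spline {n : ℕ} {x : ℕ → ℝ} (hx : ∀ i j, i < j → j ≤ n → x i < x j)
    (f s m : ℕ → ℝ) (hm0 : m 0 = 0) (hmn : m n = 0)
    (hs : ∀ k < n, s (k + 1) = s k + (x (k + 1) - x k) * (m k + m (k + 1)) / 2)
    (hf : ∀ k < n, f (k + 1) = f k + (x (k + 1) - x k) * s k +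
      (x (k + 1) - x k) ^ 2 * (2 * m k + m (k + 1)) / 6) :
    ∃ F F₁ F₂ : ℝ → ℝ, (∀ t, HasDerivAt F (F₁ t) t) ∧ (∀ t, HasDerivAt F₁ (F₂ t) t) ∧
      Continuous F₂ ∧ (∀ k ≤ n, F (x k) = f k) ∧
      (∀ k < n, ∀ t ∈ Set.Icc (x k) (x (k + 1)),
        F₂ t = m k + (m (k + 1) - m k) / (x (k + 1) - x k) * (t - x k)) ∧
      (∀ t, t ≤ x 0 → F₂ t = 0) ∧ (∀ t, x n ≤ t → F₂ t = 0) := by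
  -- `q k` is the third derivative after the knot `k`, and `c k` its jump there
  let q : ℕ → ℝ := fun k => if k < n then (m (k + 1) - m k) / (x (k + 1) - x k) else 0
  let c : ℕ → ℝ := fun k => q k - if k = 0 then 0 else q (k - 1)
  have hq : ∀ k < n, m (k + 1) = m k + q k * (x (k + 1) - x k) := by
    intro k hk
    have : x (k + 1) - x k ≠ 0 := (sub_pos.mpr (hx k (k + 1) (by omega) (by omega))).ne'
    simp only [q, hk, if_true]
    field_simp
    ring
  have hc : ∀ k, c (k + 1) = q (k + 1) - q k := fun k => by simp [c]
  have cubic : ∀ k ≤ n, ∀ t, f 0 + s 0 * (t - x 0) +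
      ∑ j ∈ Finset.range (k + 1), c j * (t - x j) ^ 3 / 6 =
      f k + s k * (t - x k) + m k * (t - x k) ^ 2 / 2 + q k * (t - x k) ^ 3 / 6 := by
    intro k
    induction k with
    | zero =>
      intro _ t
      simp [c, hm0]
    | succ k ih =>
      intro hk t
      rw [Finset.sum_range_succ, ← add_assoc, ih (by omega), hc, hf k (by omega), hs k (by omega),
        hq k (by omega)]
      ring
  have affine : ∀ k ≤ n, ∀ t, ∑ j ∈ Finset.range (k + 1), c j * (t - x j) ^ 1 =
      m k + q k * (t - x k) := by
    intro k
    induction k with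
    | zero =>
      intro _ t
      simp [c, hm0]
    | succ k ih =>
      intro hk t
      rw [Finset.sum_range_succ, ih (by omega), hc, hq k (by omega)]
      ring
  have hmax : ∀ (e : ℕ) (a t : ℝ), HasDerivAt (fun t => max (t - a) 0 ^ (e + 2))
      ((e + 2) * max (t - a) 0 ^ (e + 1)) t := fun e a t => by
    simpa using (hasDerivAt_max_zero_pow e (t - a)).comp_sub_const t a
  refine ⟨fun t => f 0 + s 0 * (t - x 0) +
      ∑ j ∈ Finset.range (n + 1), c j * max (t - x j) 0 ^ 3 / 6,
    fun t => s 0 + ∑ j ∈ Finset.range (n + 1), c j * max (t - x j) 0 ^ 2 / 2,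
    fun t => ∑ j ∈ Finset.range (n + 1), c j * max (t - x j) 0 ^ 1, ?_, ?_, ?_, ?_, ?_, ?_, ?_⟩
  · intro t
    refine (((((hasDerivAt_id t).sub_const (x 0)).const_mul (s 0)).const_add (f 0)).add
      (HasDerivAt.fun_sum fun j _ =>
        (((hmax 1 (x j) t).const_mul (c j)).div_const 6))).congr_deriv ?_
    rw [mul_one]
    congr 1
    refine Finset.sum_congr rfl fun j _ => ?_
    norm_num
    ring
  · intro t
    refine ((HasDerivAt.fun_sum fun j _ =>
        (((hmax 0 (x j) t).const_mul (c j)).div_const 2)).const_add (s 0)).congr_deriv ?_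
    refine Finset.sum_congr rfl fun j _ => ?_
    norm_num
    ring
  · fun_prop
  · intro k hk
    have h := sum_mul_max_pow_eq hx (fun j => c j / 6) (e := 3) (by norm_num) hk le_rfl
      (fun hkn => (hx k (k + 1) (by omega) (by omega)).le)
    have h' := cubic k hk (x k)
    simp only [div_mul_eq_mul_div] at h
    simp only [h, h', sub_self]
    ring
  · intro k hk t ht
    have h := affine k hk.le t
    rw [← sum_mul_max_pow_eq hx c one_ne_zero hk.le ht.1 fun _ => ht.2] at h
    simp only [h, q, hk, if_true]
  · intro t ht
    refine Finset.sum_eq_zero fun j hj => ?_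
    rw [Finset.mem_range] at hj
    have : x 0 ≤ x j := by
      rcases Nat.eq_zero_or_pos j with rfl | h
      · rfl
      · exact (hx 0 j h (by omega)).le
    rw [max_eq_right (by linarith), pow_one, mul_zero]
  · intro t ht
    have h := affine n le_rfl t
    rw [← sum_mul_max_pow_eq hx c one_ne_zero le_rfl ht fun h => absurd h (lt_irrefl n)] at h
    simp only [h, hmn, q, lt_irrefl, if_false]
    ring

/-! ### The least squares problem -/

theorem roughTerm_eq {x : ℕ → ℝ} {p : ℝ} (hp : p ≤ 1) (v : ℕ → ℝ) {k : ℕ}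
    (hx : x k < x (k + 1)) :
    roughTerm x p v k = (1 - p) * hermiteEnergy (x (k + 1) - x k) (v (2 * k)) (v (2 * k + 1))
      (v (2 * k + 2)) (v (2 * k + 3)) := by
  have hd : 0 < x (k + 1) - x k := sub_pos.mpr hx
  set d := x (k + 1) - x k with hd'
  have hs : √d ≠ 0 := (Real.sqrt_pos.mpr hd).ne'
  have h3 : √3 ^ 2 = (3 : ℝ) := Real.sq_sqrt (by norm_num)
  have hβ : √(1 - p) ^ 2 = 1 - p := Real.sq_sqrt (by linarith)
  have hdd : d = √d ^ 2 := (Real.sq_sqrt hd.le).symm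
  simp only [roughTerm, hermiteFactor, beta, Fin.sum_univ_two, Fin.sum_univ_four, ← hd',
    rpow_three_halves hd.le]
  simp
  conv_rhs => rw [← hβ, hermiteEnergy]
  generalize √d = e at *
  rw [hdd]
  generalize √3 = w at *
  have h12 : (12 : ℝ) = 4 * w ^ 2 := by rw [h3]; norm_num
  rw [h12]
  field_simp
  ring

theorem dataTerm_neg_one {y δ : ℕ → ℝ} {p : ℝ} (hp : 0 ≤ p) (v : ℕ → ℝ) (i : ℕ) :
    dataTerm y δ p v (-1) i = p * ((y i - v (2 * i)) / δ i) ^ 2 := by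
  unfold dataTerm alpha
  have h : √p ^ 2 = p := Real.sq_sqrt hp
  conv_rhs => rw [← h]
  ring

/-- The matrix `A⁽ʳ⁾` is injective. -/
theorem eq_zero_of_systemNorm_eq_zero {x y δ : ℕ → ℝ} {p : ℝ} (hp0 : 0 < p) (hp1 : p < 1) {r : ℕ}
    (hr : 2 ≤ r) (hx : ∀ k, k + 1 < r → x k < x (k + 1)) (hδ : ∀ i < r, 0 < δ i) {v : ℕ → ℝ}
    (h : systemNorm x y δ p r v 0 = 0) : ∀ j < 2 * r, v j = 0 := by
  have hn1 : ∀ i ∈ Finset.range r, 0 ≤ dataTerm y δ p v 0 i := fun i _ => sq_nonneg _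
  have hn2 : ∀ k ∈ Finset.range (r - 1), 0 ≤ roughTerm x p v k := fun k _ =>
    Finset.sum_nonneg fun a _ => sq_nonneg _
  have h1 := (Finset.sum_eq_zero_iff_of_nonneg hn1).mp (by
    have := Finset.sum_nonneg hn1
    have := Finset.sum_nonneg hn2
    unfold systemNorm at h
    linarith)
  have h2 := (Finset.sum_eq_zero_iff_of_nonneg hn2).mp (by
    have := Finset.sum_nonneg hn1
    have := Finset.sum_nonneg hn2
    unfold systemNorm at h
    linarith)
  have heven : ∀ i < r, v (2 * i) = 0 := by
    intro i hi
    have h3 := h1 i (Finset.mem_range.mpr hi)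
    have hα : alpha δ p i ≠ 0 := (div_pos (Real.sqrt_pos.mpr hp0) (hδ i hi)).ne'
    simpa [dataTerm, hα] using h3
  have hodd : ∀ k, k + 1 < r → v (2 * k + 1) = 0 ∧ v (2 * k + 3) = 0 := by
    intro k hk
    have h3 := h2 k (Finset.mem_range.mpr (by omega))
    have hd : 0 < x (k + 1) - x k := sub_pos.mpr (hx k hk)
    have e1 := heven k (by omega)
    have e2 := heven (k + 1) hk
    rw [show 2 * (k + 1) = 2 * k + 2 by ring] at e2
    rw [roughTerm_eq hp1.le v (hx k hk), mul_eq_zero, or_iff_right (by linarith), e1, e2,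
      hermiteEnergy] at h3
    have h4 := (add_eq_zero_iff_of_nonneg (by positivity) (by positivity)).mp h3
    have h5 : v (2 * k + 1) + v (2 * k + 3) = 0 := by
      simpa [hd.ne'] using h4.1
    have h6 : v (2 * k + 1) - v (2 * k + 3) = 0 := by
      simpa [hd.ne'] using h4.2
    constructor <;> linarith
  intro j hj
  obtain ⟨i, rfl | rfl⟩ : ∃ i, j = 2 * i ∨ j = 2 * i + 1 := ⟨j / 2, by omega⟩
  · exact heven i (by omega)
  · rcases Nat.lt_or_ge (i + 1) r with hi | hi
    · exact (hodd i hi).1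
    · have := (hodd (i - 1) (by omega)).2
      rwa [show 2 * (i - 1) + 3 = 2 * i + 1 by omega] at this

theorem sum_res_sq_le_storedNorm (mem : Field × ℕ → ℝ) (r : ℕ) (v : ℕ → ℝ) :
    ∑ i ∈ Finset.range (r - 2), mem (.res, i + 2) ^ 2 ≤ storedNorm mem r v (-1) := by
  have h : 0 ≤ ∑ k ∈ Finset.range r, storedTerm mem v (-1) k :=
    Finset.sum_nonneg fun k _ => Finset.sum_nonneg fun a _ => sq_nonneg _
  simp only [storedNorm, neg_one_mul, neg_sq]
  linarith

/-- Back substitution: the triangular part of the stored system is solvable. -/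
theorem exists_storedNorm_eq_sum_res_sq {x y δ : ℕ → ℝ} {p : ℝ} (hp0 : 0 < p) (hp1 : p < 1) {r : ℕ}
    (hr : 2 ≤ r) (hx : ∀ k, k + 1 < r → x k < x (k + 1)) (hδ : ∀ i < r, 0 < δ i)
    {mem : Field × ℕ → ℝ} (h : ∀ v t, systemNorm x y δ p r v t = storedNorm mem r v t) :
    ∃ v : ℕ → ℝ,
      storedNorm mem r v (-1) = ∑ i ∈ Finset.range (r - 2), mem (.res, i + 2) ^ 2 := by
  have extend_add : ∀ v w : Fin (2 * r) → ℝ, ∀ j, extend (v + w) j = extend v j + extend w j := by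
    intro v w j
    unfold extend
    split_ifs <;> simp
  have extend_smul : ∀ (a : ℝ) (v : Fin (2 * r) → ℝ), ∀ j, extend (a • v) j = a * extend v j := by
    intro a v j
    unfold extend
    split_ifs <;> simp
  let T : (Fin (2 * r) → ℝ) →ₗ[ℝ] (Fin (2 * r) → ℝ) :=
    { toFun := fun v i => storedRow mem (extend v) (i.val / 2) (i.val % 2)
      map_add' := fun v w => by
        ext i
        simp only [storedRow, extend_add, mul_add, Finset.sum_add_distrib, Pi.add_apply]
      map_smul' := fun a v => by
        ext i
        simp only [storedRow, extend_smul, RingHom.id_apply, Pi.smul_apply, smul_eq_mul,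
          Finset.mul_sum]
        exact Finset.sum_congr rfl fun b _ => by ring }
  have hT : ∀ v k (a : Fin 2), ∀ hk : k < r,
      storedRow mem (extend v) k a = T v ⟨2 * k + a, by omega⟩ := by
    intro v k a hk
    have ha := a.isLt
    simp only [T, LinearMap.coe_mk, AddHom.coe_mk]
    congr 1 <;> omega
  have hinj : Function.Injective T := by
    rw [← LinearMap.ker_eq_bot, LinearMap.ker_eq_bot']
    intro v hv
    have h1 : storedNorm mem r (extend v) 0 = 0 := by
      unfold storedNorm
      rw [Finset.sum_eq_zero, Finset.sum_eq_zero, add_zero]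
      · intro i _
        simp
      · intro k hk
        refine Finset.sum_eq_zero fun a _ => ?_
        rw [hT v k a (Finset.mem_range.mp hk), hv]
        simp
    rw [← h] at h1
    have h2 := eq_zero_of_systemNorm_eq_zero hp0 hp1 hr hx hδ h1
    ext j
    have h3 := h2 j j.isLt
    simpa [extend] using h3
  -- an injective endomorphism is surjective, so the residuals of the first `2 r` rows can be zero
  obtain ⟨v, hv⟩ := (LinearMap.injective_iff_surjective.mp hinj)
    (fun i => mem (.R (i.val % 2) 4, i.val / 2))
  refine ⟨extend v, ?_⟩
  unfold storedNorm
  rw [Finset.sum_eq_zero, zero_add]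
  · simp
  · intro k hk
    refine Finset.sum_eq_zero fun a _ => ?_
    have ha := a.isLt
    rw [hT v k a (Finset.mem_range.mp hk), hv]
    simp only [show (2 * k + a.val) % 2 = a by omega, show (2 * k + a.val) / 2 = k by omega]
    ring

theorem eq_zero_of_forall_nonneg {B C : ℝ} (h : ∀ ε : ℝ, 0 ≤ 2 * ε * B + ε ^ 2 * C) : B = 0 := by
  have h1 := discrim_le_zero (a := C) (b := 2 * B) (c := 0) fun ε => by
    have := h ε
    linarith
  unfold discrim at h1
  nlinarith

/-- At a minimizer of the least squares functional, the second derivatives of adjacent cubic pieces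
agree, and they vanish at the two ends. This is stationarity with respect to the slopes. -/
theorem exists_moments_of_minimizer {x y δ : ℕ → ℝ} {p : ℝ} (hp1 : p < 1) {n : ℕ}
    (hx : ∀ k < n, x k < x (k + 1)) {v : ℕ → ℝ}
    (hv : ∀ w, systemNorm x y δ p (n + 1) v (-1) ≤ systemNorm x y δ p (n + 1) w (-1)) :
    ∃ m : ℕ → ℝ, m 0 = 0 ∧ m n = 0 ∧ ∀ k < n,
      leftMoment (x (k + 1) - x k) (v (2 * k)) (v (2 * k + 1)) (v (2 * k + 2)) (v (2 * k + 3)) =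
        m k ∧
      rightMoment (x (k + 1) - x k) (v (2 * k)) (v (2 * k + 1)) (v (2 * k + 2)) (v (2 * k + 3)) =
        m (k + 1) := by
  let ml : ℕ → ℝ := fun k =>
    leftMoment (x (k + 1) - x k) (v (2 * k)) (v (2 * k + 1)) (v (2 * k + 2)) (v (2 * k + 3))
  let mr : ℕ → ℝ := fun k =>
    rightMoment (x (k + 1) - x k) (v (2 * k)) (v (2 * k + 1)) (v (2 * k + 2)) (v (2 * k + 3))
  have hstat : ∀ σ : ℕ → ℝ, ∑ k ∈ Finset.range n, (mr k * σ (k + 1) - ml k * σ k) = 0 := by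
    intro σ
    have hq : 0 < 1 - p := by linarith
    refine eq_zero_of_forall_nonneg
      (C := ∑ k ∈ Finset.range n, hermiteEnergy (x (k + 1) - x k) 0 (σ k) 0 (σ (k + 1))) fun ε => ?_
    -- the perturbation moves the slopes (odd indices) by `ε σ` and keeps the values
    have h1 := hv fun j => v j + if j % 2 = 0 then 0 else ε * σ (j / 2)
    simp only [systemNorm, Nat.add_sub_cancel] at h1
    have h2 : ∀ i, dataTerm y δ p (fun j => v j + if j % 2 = 0 then 0 else ε * σ (j / 2)) (-1) i =
        dataTerm y δ p v (-1) i := by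
      intro i
      simp [dataTerm]
    have h3 : ∀ k ∈ Finset.range n,
        roughTerm x p (fun j => v j + if j % 2 = 0 then 0 else ε * σ (j / 2)) k =
        roughTerm x p v k + (1 - p) * (2 * ε * (mr k * σ (k + 1) - ml k * σ k) +
          ε ^ 2 * hermiteEnergy (x (k + 1) - x k) 0 (σ k) 0 (σ (k + 1))) := by
      intro k hk
      have hk' := hx k (Finset.mem_range.mp hk)
      rw [roughTerm_eq hp1.le _ hk', roughTerm_eq hp1.le _ hk']
      simp only [show 2 * k % 2 = 0 by omega, show (2 * k + 1) % 2 = 1 by omega,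
        show (2 * k + 2) % 2 = 0 by omega, show (2 * k + 3) % 2 = 1 by omega,
        show (2 * k + 1) / 2 = k by omega, show (2 * k + 3) / 2 = k + 1 by omega, if_true,
        one_ne_zero, if_false, add_zero]
      rw [hermiteEnergy_slopes_add (sub_pos.mpr hk').ne']
      ring
    simp only [h2] at h1
    rw [Finset.sum_congr rfl h3, Finset.sum_add_distrib, ← Finset.mul_sum, Finset.sum_add_distrib,
      ← Finset.mul_sum, ← Finset.mul_sum] at h1
    refine (mul_nonneg_iff_of_pos_left hq).mp ?_
    linarith
  have hsum : ∀ (a : ℕ → ℝ) (i : ℕ), ∑ k ∈ Finset.range n, a k * (if k = i then 1 else 0) =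
      if i < n then a i else 0 := by
    intro a i
    simp
  refine ⟨fun k => if k < n then ml k else 0, ?_, by simp, fun k hk => ⟨by simp [hk, ml], ?_⟩⟩
  · have h := hstat fun j => if j = 0 then 1 else 0
    rw [Finset.sum_sub_distrib] at h
    simp only [hsum, Nat.succ_ne_zero, if_false, mul_zero, Finset.sum_const_zero, zero_sub,
      neg_eq_zero] at h
    exact h
  · have h := hstat fun j => if j = k + 1 then 1 else 0
    simp only [Finset.sum_sub_distrib, hsum, Nat.add_right_cancel_iff, hk, if_true] at h
    exact sub_eq_zero.mp h

/-! ### The spline energy -/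

theorem uniqueDiffOn_of_ordConnected {I : Set ℝ} (hI : I.OrdConnected) {a b : ℝ} (ha : a ∈ I)
    (hb : b ∈ I) (hab : a < b) : UniqueDiffOn ℝ I := by
  refine uniqueDiffOn_convex hI.convex ⟨(a + b) / 2, ?_⟩
  refine interior_mono (hI.out ha hb) ?_
  rw [interior_Icc]
  constructor <;> linarith

theorem sum_integral_Icc {g : ℝ → ℝ} {x : ℕ → ℝ} {n : ℕ} (hx : ∀ k < n, x k < x (k + 1))
    (hg : ContinuousOn g (Set.Icc (x 0) (x n))) (hmono : ∀ k ≤ n, x 0 ≤ x k ∧ x k ≤ x n) :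
    ∑ k ∈ Finset.range n, ∫ t in x k..x (k + 1), g t = ∫ t in Set.Icc (x 0) (x n), g t := by
  rw [intervalIntegral.sum_integral_adjacent_intervals, intervalIntegral.integral_of_le
    (hmono 0 (by omega)).2, MeasureTheory.integral_Icc_eq_integral_Ioc]
  intro k hk
  refine ContinuousOn.intervalIntegrable (hg.mono ?_)
  rw [Set.uIcc_of_le (hx k hk).le]
  exact Set.Icc_subset_Icc (hmono k (by omega)).1 (hmono (k + 1) (by omega)).2

theorem splineFunctional_eq {N : ℕ} {x y δ : ℕ → ℝ} {p : ℝ} {I : Set ℝ} {r : ℕ} (hrN : r ≤ N)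
    (hI : ∀ i, i < N → (x i ∈ I ↔ i < r)) (f : ℝ → ℝ) :
    splineFunctional N x y δ p I f = p * ∑ i ∈ Finset.range r, ((y i - f (x i)) / δ i) ^ 2 +
      (1 - p) * ∫ t in I, (iteratedDerivWithin 2 f I t) ^ 2 := by
  unfold splineFunctional
  congr 3
  ext i
  simp only [Finset.mem_filter, Finset.mem_range]
  constructor
  · rintro ⟨h1, h2⟩
    exact (hI i h1).mp h2
  · intro h
    exact ⟨by omega, (hI i (by omega)).mpr h⟩

/-- With one site, a constant function has energy zero. The interval may be a single point. -/
theorem isSplineEnergy_one {N : ℕ} {x y δ : ℕ → ℝ} {p : ℝ} (hp0 : 0 < p) (hp1 : p < 1)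
    (hN : 1 ≤ N) {I : Set ℝ} (hI : ∀ i, i < N → (x i ∈ I ↔ i < 1)) :
    IsSplineEnergy N x y δ p I 0 := by
  constructor
  · refine ⟨fun _ => y 0, ⟨contDiffOn_const, ?_⟩, ?_⟩
    · simp [iteratedDerivWithin_const]
    · rw [splineFunctional_eq hN hI]
      simp [iteratedDerivWithin_const]
  · rintro _ ⟨f, -, rfl⟩
    rw [splineFunctional_eq hN hI]
    have h1 : 0 ≤ ∫ t in I, (iteratedDerivWithin 2 f I t) ^ 2 :=
      MeasureTheory.integral_nonneg fun t => sq_nonneg _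
    have h2 : 0 ≤ ∑ i ∈ Finset.range 1, ((y i - f (x i)) / δ i) ^ 2 :=
      Finset.sum_nonneg fun i _ => sq_nonneg _
    have h3 : 0 < 1 - p := by linarith
    positivity

theorem systemNorm_neg_one {x y δ : ℕ → ℝ} {p : ℝ} (hp0 : 0 ≤ p) (hp1 : p ≤ 1) {n : ℕ}
    (hx : ∀ k < n, x k < x (k + 1)) (v : ℕ → ℝ) :
    systemNorm x y δ p (n + 1) v (-1) =
      p * ∑ i ∈ Finset.range (n + 1), ((y i - v (2 * i)) / δ i) ^ 2 +
      (1 - p) * ∑ k ∈ Finset.range n, hermiteEnergy (x (k + 1) - x k) (v (2 * k)) (v (2 * k + 1))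
        (v (2 * k + 2)) (v (2 * k + 3)) := by
  rw [systemNorm, Finset.mul_sum, Finset.mul_sum, Nat.add_sub_cancel]
  congr 1
  · exact Finset.sum_congr rfl fun i _ => dataTerm_neg_one hp0 v i
  · exact Finset.sum_congr rfl fun k hk => roughTerm_eq hp1 v (hx k (Finset.mem_range.mp hk))

/-- The least squares functional at the Hermite data of `f` bounds the spline functional of `f`
from below. -/
theorem exists_systemNorm_le_splineFunctional {N : ℕ} {x y δ : ℕ → ℝ} {p : ℝ} (hp0 : 0 < p)
    (hp1 : p < 1) {n : ℕ} (hn : 1 ≤ n) (hnN : n + 1 ≤ N)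
    (hx : ∀ i j, i < j → j ≤ n → x i < x j) {I : Set ℝ} (hIc : I.OrdConnected)
    (hI : ∀ i, i < N → (x i ∈ I ↔ i < n + 1)) {f : ℝ → ℝ} (hf : ContDiffOn ℝ 2 f I)
    (hint : MeasureTheory.IntegrableOn (fun t => (iteratedDerivWithin 2 f I t) ^ 2) I) :
    ∃ v, systemNorm x y δ p (n + 1) v (-1) ≤ splineFunctional N x y δ p I f := by
  have hx' : ∀ k < n, x k < x (k + 1) := fun k hk => hx k (k + 1) (by omega) (by omega)
  have hxI : ∀ k ≤ n, x k ∈ I := fun k hk => (hI k (by omega)).mpr (by omega)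
  have hmono : ∀ k ≤ n, x 0 ≤ x k ∧ x k ≤ x n := by
    intro k hk
    constructor
    · rcases Nat.eq_zero_or_pos k with rfl | h
      · rfl
      · exact (hx 0 k h hk).le
    · rcases hk.lt_or_eq with h | rfl
      · exact (hx k n h le_rfl).le
      · rfl
  have hu := uniqueDiffOn_of_ordConnected hIc (hxI 0 (by omega)) (hxI n le_rfl)
    (hx 0 n (by omega) le_rfl)
  set f₁ := derivWithin f I with hf₁
  set f₂ := iteratedDerivWithin 2 f I with hf₂
  have e2 : f₂ = derivWithin f₁ I := by
    rw [hf₂, hf₁, iteratedDerivWithin_succ', iteratedDerivWithin_one]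
  have hone : ContDiffOn ℝ 1 f₁ I := hf.derivWithin hu (by norm_num)
  have c0 : ContinuousOn f I := hf.continuousOn
  have c1 : ContinuousOn f₁ I := hone.continuousOn
  have c2 : ContinuousOn f₂ I := by
    rw [e2]
    exact hone.continuousOn_derivWithin hu le_rfl
  have d1 : DifferentiableOn ℝ f I := hf.differentiableOn (by norm_num)
  have d2 : DifferentiableOn ℝ f₁ I := hone.differentiableOn one_ne_zero
  refine ⟨fun j => if j % 2 = 0 then f (x (j / 2)) else f₁ (x (j / 2)), ?_⟩
  rw [systemNorm_neg_one hp0.le hp1.le hx', splineFunctional_eq hnN hI]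
  simp only [show ∀ k, 2 * k % 2 = 0 by intro k; omega,
    show ∀ k, (2 * k + 1) % 2 = 1 by intro k; omega,
    show ∀ k, (2 * k + 2) % 2 = 0 by intro k; omega,
    show ∀ k, (2 * k + 3) % 2 = 1 by intro k; omega,
    show ∀ k, 2 * k / 2 = k by intro k; omega,
    show ∀ k, (2 * k + 1) / 2 = k by intro k; omega,
    show ∀ k, (2 * k + 2) / 2 = k + 1 by intro k; omega,
    show ∀ k, (2 * k + 3) / 2 = k + 1 by intro k; omega, if_true, one_ne_zero, if_false]
  have hsub : Set.Icc (x 0) (x n) ⊆ I := hIc.out (hxI 0 (by omega)) (hxI n le_rfl)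
  have h1 : ∑ k ∈ Finset.range n, hermiteEnergy (x (k + 1) - x k) (f (x k)) (f₁ (x k))
      (f (x (k + 1))) (f₁ (x (k + 1))) ≤ ∫ t in I, f₂ t ^ 2 := by
    calc _ ≤ ∑ k ∈ Finset.range n, ∫ t in x k..x (k + 1), f₂ t ^ 2 := by
          refine Finset.sum_le_sum fun k hk => ?_
          rw [Finset.mem_range] at hk
          have hs : Set.Icc (x k) (x (k + 1)) ⊆ I := hIc.out (hxI k hk.le) (hxI (k + 1) hk)
          have hnhds : ∀ t ∈ Set.Ioo (x k) (x (k + 1)), I ∈ nhds t := fun t ht =>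
            Filter.mem_of_superset (Icc_mem_nhds ht.1 ht.2) hs
          refine hermiteEnergy_le_integral (hx' k hk) (c0.mono hs) (c1.mono hs) (c2.mono hs) ?_ ?_
          · intro t ht
            exact (d1 t (hs (Set.Ioo_subset_Icc_self ht))).hasDerivWithinAt.hasDerivAt (hnhds t ht)
          · intro t ht
            rw [e2]
            exact (d2 t (hs (Set.Ioo_subset_Icc_self ht))).hasDerivWithinAt.hasDerivAt (hnhds t ht)
      _ = ∫ t in Set.Icc (x 0) (x n), f₂ t ^ 2 :=
          sum_integral_Icc hx' ((c2.mono hsub).pow 2) hmono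
      _ ≤ ∫ t in I, f₂ t ^ 2 := by
          refine MeasureTheory.setIntegral_mono_set hint ?_ ?_
          · exact Filter.Eventually.of_forall fun t => sq_nonneg _
          · exact Filter.Eventually.of_forall hsub
  have h3 : 0 < 1 - p := by linarith
  gcongr

/-- The natural spline through the minimizing Hermite data attains the least squares functional. -/
theorem exists_splineFunctional_eq_systemNorm {N : ℕ} {x y δ : ℕ → ℝ} {p : ℝ} (hp0 : 0 < p)
    (hp1 : p < 1) {n : ℕ} (hn : 1 ≤ n) (hnN : n + 1 ≤ N)
    (hx : ∀ i j, i < j → j ≤ n → x i < x j) {I : Set ℝ} (hIc : I.OrdConnected)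
    (hI : ∀ i, i < N → (x i ∈ I ↔ i < n + 1)) {v : ℕ → ℝ}
    (hv : ∀ w, systemNorm x y δ p (n + 1) v (-1) ≤ systemNorm x y δ p (n + 1) w (-1)) :
    ∃ f, ContDiffOn ℝ 2 f I ∧
      MeasureTheory.IntegrableOn (fun t => (iteratedDerivWithin 2 f I t) ^ 2) I ∧
      splineFunctional N x y δ p I f = systemNorm x y δ p (n + 1) v (-1) := by
  have hx' : ∀ k < n, x k < x (k + 1) := fun k hk => hx k (k + 1) (by omega) (by omega)
  have hxI : ∀ k ≤ n, x k ∈ I := fun k hk => (hI k (by omega)).mpr (by omega)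
  have hmono : ∀ k ≤ n, x 0 ≤ x k ∧ x k ≤ x n := by
    intro k hk
    constructor
    · rcases Nat.eq_zero_or_pos k with rfl | h
      · rfl
      · exact (hx 0 k h hk).le
    · rcases hk.lt_or_eq with h | rfl
      · exact (hx k n h le_rfl).le
      · rfl
  have hu := uniqueDiffOn_of_ordConnected hIc (hxI 0 (by omega)) (hxI n le_rfl)
    (hx 0 n (by omega) le_rfl)
  obtain ⟨m, hm0, hmn, hm⟩ := exists_moments_of_minimizer hp1 hx' hv
  obtain ⟨F, F₁, F₂, hF, hF₁, hF₂, hval, haff, hleft, hright⟩ :=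
    exists_natural_spline hx (fun k => v (2 * k)) (fun k => v (2 * k + 1)) m hm0 hmn
      (fun k hk => by
        have h := slope_eq_of_moments (sub_pos.mpr (hx' k hk)).ne' (v (2 * k)) (v (2 * k + 1))
          (v (2 * k + 2)) (v (2 * k + 3))
        rw [(hm k hk).1, (hm k hk).2] at h
        exact h)
      (fun k hk => by
        have h := value_eq_of_moments (sub_pos.mpr (hx' k hk)).ne' (v (2 * k)) (v (2 * k + 1))
          (v (2 * k + 2)) (v (2 * k + 3))
        rw [(hm k hk).1, (hm k hk).2] at h
        exact h)
  have hdF : deriv F = F₁ := funext fun t => (hF t).deriv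
  have hdF₁ : deriv F₁ = F₂ := funext fun t => (hF₁ t).deriv
  have hone : ContDiff ℝ 1 F₁ := by
    rw [contDiff_one_iff_deriv, hdF₁]
    exact ⟨fun t => (hF₁ t).differentiableAt, hF₂⟩
  have htwo : ContDiff ℝ 2 F := by
    rw [show (2 : WithTop ℕ∞) = 1 + 1 by norm_num, contDiff_succ_iff_deriv, hdF]
    exact ⟨fun t => (hF t).differentiableAt, by simp, hone⟩
  have hder : Set.EqOn (fun t => (iteratedDerivWithin 2 F I t) ^ 2) (fun t => F₂ t ^ 2) I := by
    intro t ht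
    simp only
    rw [iteratedDerivWithin_eq_iteratedDeriv hu htwo.contDiffAt ht, iteratedDeriv_succ',
      iteratedDeriv_one, hdF, hdF₁]
  have hmeas : MeasurableSet I := hIc.measurableSet
  have hsub : Set.Icc (x 0) (x n) ⊆ I := hIc.out (hxI 0 (by omega)) (hxI n le_rfl)
  have hoff : ∀ t, t ∉ Set.Icc (x 0) (x n) → F₂ t ^ 2 = 0 := by
    intro t ht
    rw [Set.mem_Icc, not_and_or, not_le, not_le] at ht
    rcases ht with ht | ht
    · rw [hleft t ht.le, zero_pow two_ne_zero]
    · rw [hright t ht.le, zero_pow two_ne_zero]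
  refine ⟨F, htwo.contDiffOn, ?_, ?_⟩
  · refine MeasureTheory.IntegrableOn.congr_fun (f := fun t => F₂ t ^ 2) ?_ hder.symm hmeas
    exact ((hF₂.pow 2).integrable_of_hasCompactSupport
      (HasCompactSupport.intro isCompact_Icc hoff)).integrableOn
  · rw [splineFunctional_eq hnN hI, systemNorm_neg_one hp0.le hp1.le hx',
      MeasureTheory.setIntegral_congr_fun hmeas hder,
      MeasureTheory.setIntegral_eq_of_subset_of_forall_sdiff_eq_zero hmeas hsub
        (fun t ht => hoff t ht.2),
      ← sum_integral_Icc (g := fun t => F₂ t ^ 2) hx' (hF₂.pow 2).continuousOn hmono]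
    congr 2
    · refine Finset.sum_congr rfl fun i hi => ?_
      rw [hval i (by have := Finset.mem_range.mp hi; omega)]
    · refine Finset.sum_congr rfl fun k hk => ?_
      have hk' := Finset.mem_range.mp hk
      have hd := (sub_pos.mpr (hx' k hk')).ne'
      rw [hermiteEnergy_eq_of_moments hd, (hm k hk').1, (hm k hk').2]
      rw [intervalIntegral.integral_congr
        (g := fun t => (m k + (m (k + 1) - m k) / (x (k + 1) - x k) * (t - x k)) ^ 2)]
      · rw [integral_affine_sq]
        field_simp
        ring
      · intro t ht
        rw [Set.uIcc_of_le (hx' k hk').le] at ht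
        simp only [haff k hk' t ht]

theorem isSplineEnergy_of_norm_eq {N : ℕ} {x y δ : ℕ → ℝ} {p : ℝ} (hp0 : 0 < p)
    (hp1 : p < 1) {r : ℕ} (hr : 2 ≤ r) (hrN : r ≤ N)
    (hx : ∀ i j, i < j → j < N → x i < x j) (hδ : ∀ i, i < N → 0 < δ i)
    {mem : Field × ℕ → ℝ} (h : ∀ v t, systemNorm x y δ p r v t = storedNorm mem r v t)
    {I : Set ℝ} (hIc : I.OrdConnected) (hI : ∀ i, i < N → (x i ∈ I ↔ i < r)) :
    IsSplineEnergy N x y δ p I (∑ i ∈ Finset.range (r - 2), mem (.res, i + 2) ^ 2) := by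
  obtain ⟨n, rfl⟩ : ∃ n, r = n + 1 := ⟨r - 1, by omega⟩
  obtain ⟨v, hv⟩ := exists_storedNorm_eq_sum_res_sq hp0 hp1 hr
    (fun k hk => hx k (k + 1) (by omega) (by omega)) (fun i hi => hδ i (by omega)) h
  have hmin : ∀ w, systemNorm x y δ p (n + 1) v (-1) ≤ systemNorm x y δ p (n + 1) w (-1) := by
    intro w
    rw [h, h, hv]
    exact sum_res_sq_le_storedNorm _ _ _
  rw [← hv, ← h]
  constructor
  · obtain ⟨f, h1, h2, h3⟩ := exists_splineFunctional_eq_systemNorm hp0 hp1 (by omega) hrN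
      (fun i j hij hj => hx i j hij (by omega)) hIc hI hmin
    exact ⟨f, ⟨h1, h2⟩, h3⟩
  · rintro _ ⟨f, ⟨h1, h2⟩, rfl⟩
    obtain ⟨w, hw⟩ := exists_systemNorm_le_splineFunctional (y := y) (δ := δ) hp0 hp1 (by omega) hrN
      (fun i j hij hj => hx i j hij (by omega)) hIc hI h1 h2
    exact (hmin w).trans hw

/-! ### The complete run -/

theorem Addr.cell_congr {F : Type} (a : Addr F) {s t : State F} (h : s.idx = t.idx) :
    a.cell s = a.cell t := by
  cases a <;> simp [Addr.cell, h]

/-- The cells and index registers after a run do not depend on the number of steps and the set of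
touched cells recorded before. -/
theorem exec_congr {F : Type} [DecidableEq F] (P : Prog F) {s t : State F}
    (h : s.mem = t.mem ∧ s.idx = t.idx) :
    (exec P s).mem = (exec P t).mem ∧ (exec P s).idx = (exec P t).idx := by
  have hcell : ∀ {s t : State F}, s.mem = t.mem ∧ s.idx = t.idx → ∀ a : Addr F,
      a.cell s = a.cell t := fun h a => a.cell_congr h.2
  have hread : ∀ {s t : State F}, s.mem = t.mem ∧ s.idx = t.idx → ∀ a : Addr F,
      s.read a = t.read a := fun h a => by
    simp only [State.read, hcell h, h.1]
  induction P generalizing s t with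
  | skip => exact h
  | const dst c => simp [exec, State.assign, hcell h, h.1, h.2]
  | copy dst src => simp [exec, State.assign, hcell h, hread h, h.1, h.2]
  | arith op dst a b => simp [exec, State.assign, hcell h, hread h, h.1, h.2]
  | sqrt dst a => simp [exec, State.assign, hcell h, hread h, h.1, h.2]
  | setIdx j c => simp [exec, State.assignIdx, h.1, h.2]
  | copyIdx j i => simp [exec, State.assignIdx, h.1, h.2]
  | incIdx j => simp [exec, State.assignIdx, h.1, h.2]
  | decIdx j => simp [exec, State.assignIdx, h.1, h.2]
  | seq P Q hP hQ => exact hQ (hP h)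
  | ifZero a P Q hP hQ =>
    simp only [exec, hread h]
    split_ifs
    · exact hP h
    · exact hQ h
  | ifIdxZero j P Q hP hQ =>
    simp only [exec, h.2]
    split_ifs
    · exact hP h
    · exact hQ h
  | loop j P hP =>
    have h1 : ∀ (n : ℕ) {s t : State F}, s.mem = t.mem ∧ s.idx = t.idx →
        ((exec P)^[n] s).mem = ((exec P)^[n] t).mem ∧
          ((exec P)^[n] s).idx = ((exec P)^[n] t).idx := by
      intro n
      induction n with
      | zero => exact fun h => h
      | succ n ih => exact fun h => ih (hP h)
    simp only [exec, h.2]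
    exact h1 _ h

theorem iterate_exec_congr {F : Type} [DecidableEq F] (P : Prog F) (n : ℕ) {s t : State F}
    (h : s.mem = t.mem ∧ s.idx = t.idx) :
    ((exec P)^[n] s).mem = ((exec P)^[n] t).mem := by
  induction n generalizing s t with
  | zero => exact h.1
  | succ n ih => exact ih (exec_congr P h)

theorem loopFree_rotate (j i : ℕ) : LoopFree (rotate j i) := by
  refine ⟨trivial, loopFree_block ?_⟩
  simp [LoopFree, List.range_succ, block]

theorem loopFree_loadSite (i c o : ℕ) : LoopFree (loadSite i c o) :=
  loopFree_block (by simp [LoopFree, List.range_succ])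

theorem loopFree_loadInterval (i : ℕ) : LoopFree (loadInterval i) :=
  loopFree_block (by simp [LoopFree, List.range_succ])

theorem loopFree_loadRows : LoopFree loadRows :=
  loopFree_block (by simp [LoopFree, List.range_succ])

theorem loopFree_storeRows : LoopFree storeRows :=
  loopFree_block (by simp [LoopFree, List.range_succ, block])

theorem loopFree_updateStep : LoopFree updateStep :=
  loopFree_block (by simp [LoopFree, loopFree_rotate, loopFree_loadSite, loopFree_loadInterval,
    loopFree_loadRows, loopFree_storeRows])

theorem loopFree_initTwo : LoopFree initTwo :=
  loopFree_block (by simp [LoopFree, loopFree_rotate, loopFree_loadSite, loopFree_loadInterval,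
    loopFree_storeRows])

theorem loopFree_startUp : LoopFree startUp :=
  loopFree_block (by simp [LoopFree, loopFree_initTwo])

/-- The part of the start before the test whether there are at least two sites. -/
def clearStart : Prog Field :=
  block [.setIdx 1 0, .const (.fixed .out 0) 0, .copyIdx 2 0, .decIdx 2]

theorem exec_startUp (s : State Field) : exec startUp s =
    exec (.decIdx 2) (exec (.ifIdxZero 2 .skip initTwo) (exec clearStart s)) := rfl

theorem exec_clearStart_input (N : ℕ) (x y δ : ℕ → ℝ) (p : ℝ) :
    HoldsData N x y δ p (exec clearStart (input N x y δ p)).mem ∧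
    (exec clearStart (input N x y δ p)).idx 1 = 0 ∧
    (exec clearStart (input N x y δ p)).idx 2 = N - 1 ∧
    (∀ b, (exec clearStart (input N x y δ p)).mem (.ws 4 b, 0) = 0) ∧
    (exec clearStart (input N x y δ p)).mem (.out, 0) = 0 := by
  refine ⟨⟨?_, ?_, ?_, ?_⟩, ?_, ?_, ?_, ?_⟩
  · intro i hi
    simp [clearStart, block, exec, State.assignIdx, State.mem_assign, Addr.cell, input, hi]
  · intro i hi
    simp [clearStart, block, exec, State.assignIdx, State.mem_assign, Addr.cell, input, hi]
  · intro i hi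
    simp [clearStart, block, exec, State.assignIdx, State.mem_assign, Addr.cell, input, hi]
  all_goals
    simp [clearStart, block, exec, State.assignIdx, State.mem_assign, State.idx_assign, Addr.cell,
      input]

theorem idx_two_exec_initTwo (s : State Field) : (exec initTwo s).idx 2 = s.idx 2 := by
  rw [exec_initTwo]
  have h : ∀ s, (exec finishInit s).idx 2 = s.idx 2 := fun s => by
    simp [finishInit, block, exec, State.assignIdx, State.idx_assign]
  rw [h, keepsIdx_storeRows.idx_exec, (keepsIdx_rotations _).idx_exec, keepsIdx_loadInit.idx_exec]

theorem idx_two_exec_startUp (N : ℕ) (x y δ : ℕ → ℝ) (p : ℝ) :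
    (exec startUp (input N x y δ p)).idx 2 = N - 2 := by
  obtain ⟨-, -, h, -, -⟩ := exec_clearStart_input N x y δ p
  have h1 : (exec (.ifIdxZero 2 .skip initTwo) (exec clearStart (input N x y δ p))).idx 2 =
      N - 1 := by
    rw [exec]
    split_ifs
    · exact h
    · rw [idx_two_exec_initTwo]
      exact h
  rw [exec_startUp, exec]
  simp only [State.assignIdx, Function.update_self, h1]
  omega

/-- The state of the run when `r ≥ 2` sites have been processed. -/
noncomputable def stateAfter (N : ℕ) (x y δ : ℕ → ℝ) (p : ℝ) (r : ℕ) : State Field :=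
  (exec updateStep)^[r - 2] (exec startUp (input N x y δ p))

theorem stateAfter_succ (N : ℕ) (x y δ : ℕ → ℝ) (p : ℝ) {r : ℕ} (hr : 2 ≤ r) :
    stateAfter N x y δ p (r + 1) = exec updateStep (stateAfter N x y δ p r) := by
  rw [stateAfter, stateAfter, show r + 1 - 2 = (r - 2) + 1 by omega, Function.iterate_succ_apply']

theorem mem_exec_updateScheme (N : ℕ) (x y δ : ℕ → ℝ) (p : ℝ) :
    (exec updateScheme (input N x y δ p)).mem = memAfter N x y δ p N := by
  have h := idx_two_exec_startUp N x y δ p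
  simp only [updateScheme, exec, h]
  exact iterate_exec_congr _ _ ⟨rfl, rfl⟩

/-- What holds between two updates: the stored system has the same norm as the least squares system
at all arguments, the stored matrix is triangular, and the last output is the sum of the squared
residual entries. -/
structure Invariant (N : ℕ) (x y δ : ℕ → ℝ) (p : ℝ) (r : ℕ) (s : State Field) : Prop where
  ready : Ready N x y δ p r s
  norm_eq : ∀ v t, systemNorm x y δ p r v t = storedNorm s.mem r v t
  lower : ∀ k < r, s.mem (.R 1 0, k) = 0
  out_zero : s.mem (.out, 0) = 0
  out_last : s.mem (.out, r - 1) = ∑ i ∈ Finset.range (r - 2), s.mem (.res, i + 2) ^ 2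

theorem invariant_two {N : ℕ} {x y δ : ℕ → ℝ} {p : ℝ} (hN : 2 ≤ N) (hx : x 0 < x 1) :
    Invariant N x y δ p 2 (stateAfter N x y δ p 2) := by
  obtain ⟨h1, h2, h3, h4, h5⟩ := exec_clearStart_input N x y δ p
  set s := exec clearStart (input N x y δ p) with hs
  obtain ⟨hr, hi⟩ := exec_initTwo_spec (s := s.tick 1) h1 hN h2 hx h4
  have hstate : stateAfter N x y δ p 2 = exec (.decIdx 2) (exec initTwo (s.tick 1)) := by
    rw [stateAfter, Nat.sub_self, Function.iterate_zero_apply, exec_startUp, ← hs]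
    congr 1
    rw [exec, if_neg (by omega)]
  have hmem : (stateAfter N x y δ p 2).mem = (exec initTwo (s.tick 1)).mem := by
    rw [hstate]
    rfl
  have hidx : (stateAfter N x y δ p 2).idx 1 = (exec initTwo (s.tick 1)).idx 1 := by
    rw [hstate]
    simp [exec, State.assignIdx]
  refine ⟨⟨?_, ?_, ?_, ?_⟩, ?_, ?_, ?_, ?_⟩
  · rw [hmem]; exact hr.data
  · rw [hidx]; exact hr.idx
  · rw [hmem]; exact hr.last_two
  · rw [hmem]; exact hr.last_three
  · rw [hmem]; exact storedNorm_eq_of_init hi hr.last_two hr.last_three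
  · rw [hmem]
    intro k hk
    interval_cases k
    · exact hi.lower_zero
    · exact hi.lower_one
  · rw [hmem, hi.out_zero]
    exact h5
  · rw [hmem]
    simpa using hi.out_one

theorem Invariant.update {N : ℕ} {x y δ : ℕ → ℝ} {p : ℝ} {r : ℕ} {s : State Field}
    (h : Invariant N x y δ p r s) (hr : 2 ≤ r) (hrN : r < N) (hx : x (r - 1) < x r) :
    Invariant N x y δ p (r + 1) (exec updateStep s) := by
  obtain ⟨h1, h2⟩ := h.ready.update (by omega) hrN hx
  refine ⟨h1, ?_, ?_, ?_, ?_⟩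
  · exact storedNorm_eq_of_update hr h2 h.ready.last_two h.ready.last_three h1.last_two
      h1.last_three h.norm_eq
  · intro k hk
    rcases Nat.lt_or_ge (k + 1) r with hk' | hk'
    · rw [h2.old_rows k 1 0 hk']
      exact h.lower k (by omega)
    · obtain rfl | rfl : k = r - 1 ∨ k = r := by omega
      · exact h2.lower_old
      · exact h2.lower_new
  · rw [h2.old_out 0 (by omega)]
    exact h.out_zero
  · rw [Nat.add_sub_cancel, h2.out, h.out_last, show r + 1 - 2 = r - 2 + 1 by omega,
      Finset.sum_range_succ, show r - 2 + 2 = r by omega]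
    congr 1
    refine Finset.sum_congr rfl fun i hi => ?_
    rw [Finset.mem_range] at hi
    rw [h2.old_res _ (by omega)]

theorem invariant_stateAfter {N : ℕ} {x y δ : ℕ → ℝ} {p : ℝ}
    (hx : ∀ i j, i < j → j < N → x i < x j) {r : ℕ} (hr : 2 ≤ r) (hrN : r ≤ N) :
    Invariant N x y δ p r (stateAfter N x y δ p r) := by
  induction r, hr using Nat.le_induction with
  | base => exact invariant_two hrN (hx 0 1 (by omega) (by omega))
  | succ r hr ih =>
    rw [stateAfter_succ N x y δ p hr]
    exact (ih (by omega)).update hr (by omega) (hx _ _ (by omega) (by omega))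

theorem updateSpec_memAfter {N : ℕ} {x y δ : ℕ → ℝ} {p : ℝ}
    (hx : ∀ i j, i < j → j < N → x i < x j) {r : ℕ} (hr : 2 ≤ r) (hrN : r < N) :
    UpdateSpec x y δ p r (memAfter N x y δ p r) (memAfter N x y δ p (r + 1)) := by
  have h := ((invariant_stateAfter (y := y) (δ := δ) (p := p) hx hr hrN.le).ready.update
    (by omega) hrN (hx _ _ (by omega) (by omega))).2
  rwa [← stateAfter_succ N x y δ p hr] at h

theorem out_memAfter_eq {N : ℕ} {x y δ : ℕ → ℝ} {p : ℝ}
    (hx : ∀ i j, i < j → j < N → x i < x j) {r n : ℕ} (hr : 2 ≤ r) (hrn : r ≤ n) (hn : n ≤ N) :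
    memAfter N x y δ p n (.out, r - 1) = memAfter N x y δ p r (.out, r - 1) := by
  induction n, hrn using Nat.le_induction with
  | base => rfl
  | succ n hrn ih =>
    rw [(updateSpec_memAfter hx (hr.trans hrn) hn).old_out _ (by omega), ih (by omega)]

theorem out_zero_final {N : ℕ} {x y δ : ℕ → ℝ} {p : ℝ} (hN : 1 ≤ N)
    (hx : ∀ i j, i < j → j < N → x i < x j) : memAfter N x y δ p N (.out, 0) = 0 := by
  rcases Nat.lt_or_ge 1 N with h | h
  · exact (invariant_stateAfter hx h le_rfl).out_zero
  · obtain rfl : N = 1 := by omega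
    obtain ⟨-, -, h3, -, h5⟩ := exec_clearStart_input 1 x y δ p
    change (exec startUp (input 1 x y δ p)).mem (.out, 0) = 0
    rw [exec_startUp]
    have h6 : exec (.ifIdxZero 2 .skip initTwo) (exec clearStart (input 1 x y δ p)) =
        (exec clearStart (input 1 x y δ p)).tick 1 := by
      rw [exec, if_pos h3]
      rfl
    rw [h6]
    exact h5

theorem exists_steps_updateScheme_le : ∃ C : ℕ, ∀ (N : ℕ) (x y δ : ℕ → ℝ) (p : ℝ), 1 ≤ N →
    (exec updateScheme (input N x y δ p)).steps ≤ C * N := by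
  obtain ⟨K, hK⟩ := loopFree_startUp.exists_steps_le
  obtain ⟨K', hK'⟩ := loopFree_updateStep.exists_steps_le
  refine ⟨K + K' + 1, fun N x y δ p hN => ?_⟩
  have h1 := hK (input N x y δ p)
  have h2 := idx_two_exec_startUp N x y δ p
  simp only [updateScheme, exec, h2]
  refine (iterate_steps_le hK' _ _).trans ?_
  have h3 : (input N x y δ p).steps = 0 := rfl
  have h4 : (N - 2) * K' ≤ N * K' := Nat.mul_le_mul_right _ (by omega)
  have h5 : K ≤ N * K := Nat.le_mul_of_pos_left _ hN
  have h6 : (K + K' + 1) * N = N * K + N * K' + N := by ring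
  simp only [State.tick]
  omega

end CSSD

theorem mainTheorem2 :
    ∃ C : ℕ, ∀ (N : ℕ) (x y δ : ℕ → ℝ) (p : ℝ), 1 ≤ N →
      (∀ i j, i < j → j < N → x i < x j) → (∀ i, i < N → 0 < δ i) → 0 < p → p < 1 →
      -- time and memory of the complete run
      (CSSD.exec CSSD.updateScheme (CSSD.input N x y δ p)).steps ≤ C * N ∧
      (CSSD.exec CSSD.updateScheme (CSSD.input N x y δ p)).touched.card ≤ C * N ∧
      -- the output array consists of the spline energies of the prefixes
      (∀ r, 1 ≤ r → r ≤ N → ∀ I : Set ℝ, I.OrdConnected → (∀ i, i < N → (x i ∈ I ↔ i < r)) →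
        CSSD.IsSplineEnergy N x y δ p I
          ((CSSD.exec CSSD.updateScheme (CSSD.input N x y δ p)).mem (.out, r - 1))) ∧
      -- the QR decomposition held after `r` sites, and the energy as sum of squared residuals
      (∀ r, 2 ≤ r → r ≤ N →
        CSSD.IsQRSystem x y δ p r (CSSD.storedR (CSSD.memAfter N x y δ p r) r)
          (CSSD.storedZ (CSSD.memAfter N x y δ p r) r) ∧
        CSSD.memAfter N x y δ p r (.out, r - 1) =
          ∑ i ∈ Finset.univ.filter (fun i : Fin (3 * r - 2) => 2 * r ≤ i.val),
            CSSD.storedZ (CSSD.memAfter N x y δ p r) r i ^ 2) ∧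
      -- the update from `r` to `r + 1` sites
      (∀ r, 2 ≤ r → r < N →
        (∃ L : List (Matrix (Fin 5) (Fin 5) ℝ), L.length ≤ 10 ∧
          (∀ G ∈ L, CSSD.IsGivensRotation G) ∧
          L.prod * CSSD.smallSystem x y δ p r (CSSD.memAfter N x y δ p r) =
            CSSD.reducedSystem r (CSSD.memAfter N x y δ p (r + 1))) ∧
        (∀ k a b, k + 1 < r → CSSD.memAfter N x y δ p (r + 1) (.R a b, k) =
          CSSD.memAfter N x y δ p r (.R a b, k)) ∧
        (∀ k, k < r → CSSD.memAfter N x y δ p (r + 1) (.res, k) =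
          CSSD.memAfter N x y δ p r (.res, k)) ∧
        CSSD.memAfter N x y δ p (r + 1) (.out, r) =
          CSSD.memAfter N x y δ p r (.out, r - 1) +
            CSSD.memAfter N x y δ p (r + 1) (.res, r) ^ 2) := by
  obtain ⟨C, hC⟩ := CSSD.exists_steps_updateScheme_le
  -- a step touches at most three cells
  refine ⟨3 * C, fun N x y δ p hN hx hδ hp0 hp1 => ⟨?_, ?_, ?_, ?_, ?_⟩⟩
  · refine (hC N x y δ p hN).trans (Nat.mul_le_mul_right _ (by omega))
  · refine (CSSD.touched_card_exec_le _ _ (by simp [CSSD.input])).trans ?_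
    rw [mul_assoc]
    exact Nat.mul_le_mul_left _ (hC N x y δ p hN)
  · intro r hr hrN I hIc hI
    rw [CSSD.mem_exec_updateScheme]
    rcases hr.lt_or_eq with hr' | rfl
    · have h := CSSD.invariant_stateAfter (y := y) (δ := δ) (p := p) hx hr' hrN
      rw [CSSD.out_memAfter_eq hx hr' hrN le_rfl]
      have h1 : CSSD.memAfter N x y δ p r (.out, r - 1) = _ := h.out_last
      rw [h1]
      exact CSSD.isSplineEnergy_of_norm_eq hp0 hp1 hr' hrN hx hδ h.norm_eq hIc hI
    · rw [Nat.sub_self, CSSD.out_zero_final hN hx]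
      exact CSSD.isSplineEnergy_one hp0 hp1 hN hI
  · intro r hr hrN
    have h := CSSD.invariant_stateAfter (y := y) (δ := δ) (p := p) hx hr hrN
    refine ⟨CSSD.isQRSystem_of_norm_eq hr h.norm_eq h.lower, ?_⟩
    rw [CSSD.sum_sq_storedZ_filter _ hr]
    exact h.out_last
  · intro r hr hrN
    have h := CSSD.updateSpec_memAfter (y := y) (δ := δ) (p := p) hx hr hrN
    exact ⟨h.rotations, h.old_rows, h.old_res, h.out⟩
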